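/- Let $(\Omega,\mu)$ be an arbitrary measure space and consider complex $L_p$-spaces. For a bounded linear operator $B$ on $L_2(\mu)$ and $q,r\in[1,\infty]$ put $$\|B\|_{q\to r}:=\sup\{\|Bf\|_r : f\in L_2(\mu)\cap L_q(\mu),\ \|f\|_q\le 1\}\in[0,\infty].$$ Let $T=(T(t))_{t\ge0}$ be a positive $C_0$-semigroup on $L_2(\mu)$ with generator $A$. For bounded measurable $W\colon\Omega\to\mathbb R$ let $T_W$ be the $C_0$-semigroup generated by $A-W$. A measurable function $W\colon\Omega\to\mathbb R$ is called $T$-admissible if for all $t\ge0$ the strong limits $\lim_{n\to\infty}T_{W^+\wedge n}(t)$ and $\lim_{n\to\infty}T_{(-W^-)\vee(-n)}(t)$ exist and both define $C_0$-semigroups on $L_2(\mu)$; in this case $T_W(t):=\lim_{n\to\infty}T_{(W\wedge n)\vee(-n)}(t)$ (strong limit, which exists and defines a $C_0$-semigroup). Assume that $T$ is ultracontractive, more precisely that there are $c,\nu>0$ with $$\|T(t)\|_{1\to\infty}\le c\,t^{-\nu}\qquad(t>0).$$ Let $V\colon\Omega\to\mathbb R$ be measurable, and assume that there exist $p>1$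 and $M\ge1$ such that $pV$ is $T$-admissible and $$\|T_{pV}(t)\|_{2\to2}\le M,\qquad \|T_V(t)\|_{1\to1}\le M,\qquad \|T_V(t)\|_{\infty\to\infty}\le M\qquad(t>0).$$ (Here $V$ is automatically $T$-admissible, so that $T_V$ is a well-defined $C_0$-semigroup on $L_2(\mu)$.) Then $T_V$ is ultracontractive: with $p'=p/(p-1)$ and $\tilde c=3^{\nu p'}\,c\,M^{2p'}$ one has $$\|T_V(t)\|_{1\to\infty}\le \tilde c\,t^{-\nu}\qquad(t>0).$$ -/

import Mathlib

open Filter Topology MeasureTheory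
open scoped NNReal ENNReal

noncomputable section

section Abstract

variable {X : Type*} [NormedAddCommGroup X] [NormedSpace ℂ X]

/-- `T : [0, ∞) → L(X)` is a `C₀`-semigroup: a one-parameter semigroup of bounded operators that is
strongly continuous on `[0, ∞)`. -/
structure IsC0Semigroup (T : ℝ≥0 → X →L[ℂ] X) : Prop where
  zero : T 0 = 1
  add : ∀ s t : ℝ≥0, T (s + t) = T s * T t
  continuous : ∀ f : X, Continuous fun t : ℝ≥0 => T t f

/-- The (graph of the) generator `A` of `T`: `f ∈ dom A` and `A f = g`, that is,
`(T(t) f - f) / t → g` as `t → 0+`. -/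
def GeneratorMapsTo (T : ℝ≥0 → X →L[ℂ] X) (f g : X) : Prop :=
  Tendsto (fun t : ℝ≥0 => (t : ℝ)⁻¹ • (T t f - f)) (𝓝[>] 0) (𝓝 g)

/-- `S(t) = s-lim_{n → ∞} Sₙ(t)` for all `t ≥ 0`. -/
def IsStrongLimit (Sn : ℕ → ℝ≥0 → X →L[ℂ] X) (S : ℝ≥0 → X →L[ℂ] X) : Prop :=
  ∀ (t : ℝ≥0) (f : X), Tendsto (fun n => Sn n t f) atTop (𝓝 (S t f))

end Abstract

section LTwo

variable {Ω : Type*} [MeasurableSpace Ω] {μ : Measure Ω}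

/-- Each `T(t)` is a positive operator on the complex space `L₂(μ)`: it maps (classes of) functions
with values in `[0, ∞)` a.e. to such functions. -/
def IsPositiveFamily (T : ℝ≥0 → Lp ℂ 2 μ →L[ℂ] Lp ℂ 2 μ) : Prop :=
  ∀ (t : ℝ≥0) (f : Lp ℂ 2 μ), (∀ᵐ x ∂μ, 0 ≤ (f x).re ∧ (f x).im = 0) →
    ∀ᵐ x ∂μ, 0 ≤ (T t f x).re ∧ (T t f x).im = 0

/-- `‖B‖_{q → r} = sup {‖B f‖_r : f ∈ L₂ ∩ L_q, ‖f‖_q ≤ 1} ∈ [0, ∞]` for an operator `B` on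
`L₂(μ)`. -/
def normFromTo (q r : ℝ≥0∞) (B : Lp ℂ 2 μ →L[ℂ] Lp ℂ 2 μ) : ℝ≥0∞ :=
  ⨆ (f : Lp ℂ 2 μ) (_ : eLpNorm f q μ ≤ 1), eLpNorm (B f) r μ

/-- For a bounded measurable `V`: `S` is the `C₀`-semigroup generated by `A - V`, where `A` is the
generator of `T` (so that `dom (A - V) = dom A`). -/
def IsBoundedPerturbation (T : ℝ≥0 → Lp ℂ 2 μ →L[ℂ] Lp ℂ 2 μ) (V : Ω → ℝ)
    (S : ℝ≥0 → Lp ℂ 2 μ →L[ℂ] Lp ℂ 2 μ) : Prop :=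
  IsC0Semigroup S ∧ ∀ f g : Lp ℂ 2 μ, GeneratorMapsTo S f g ↔
    ∃ h : Lp ℂ 2 μ, GeneratorMapsTo T f h ∧ ∀ᵐ x ∂μ, g x = h x - (V x : ℂ) * f x

open Classical in
/-- `T_V` for a bounded measurable potential `V`: the `C₀`-semigroup generated by `A - V`.
(It exists for every `C₀`-semigroup `T` by bounded perturbation, and it is unique; the value `0`
is never taken for such `T` and `V`.) -/
def boundedPerturbation (T : ℝ≥0 → Lp ℂ 2 μ →L[ℂ] Lp ℂ 2 μ) (V : Ω → ℝ) :
    ℝ≥0 → Lp ℂ 2 μ →L[ℂ] Lp ℂ 2 μ :=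
  if h : ∃ S, IsBoundedPerturbation T V S then h.choose else 0

/-- A measurable `V : Ω → ℝ` is `T`-admissible if both `V⁺` and `-V⁻` are: the strong limits
of `T_{V⁺ ∧ n}` and of `T_{(-V⁻) ∨ (-n)}` exist and are `C₀`-semigroups. -/
def IsAdmissible (T : ℝ≥0 → Lp ℂ 2 μ →L[ℂ] Lp ℂ 2 μ) (V : Ω → ℝ) : Prop :=
  Measurable V ∧
  (∃ S, IsC0Semigroup S ∧
    IsStrongLimit (fun n : ℕ => boundedPerturbation T fun x => min (max (V x) 0) (n : ℝ)) S) ∧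
  (∃ S, IsC0Semigroup S ∧
    IsStrongLimit (fun n : ℕ => boundedPerturbation T fun x => max (min (V x) 0) (-(n : ℝ))) S)

open Classical in
/-- `T_V(t) = s-lim_{n → ∞} T_{(V ∧ n) ∨ (-n)}(t)`; for bounded `V` the sequence is eventually
constant, equal to `T_V(t)`. (The limit exists if `V` is `T`-admissible and `T` is a positive
`C₀`-semigroup; the value is `0` if it does not exist.) -/
def perturbedSemigroup (T : ℝ≥0 → Lp ℂ 2 μ →L[ℂ] Lp ℂ 2 μ) (V : Ω → ℝ) :
    ℝ≥0 → Lp ℂ 2 μ →L[ℂ] Lp ℂ 2 μ :=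
  if h : ∃ S, IsStrongLimit
      (fun n : ℕ => boundedPerturbation T fun x => max (min (V x) (n : ℝ)) (-(n : ℝ))) S
  then h.choose else 0

end LTwo

end

/-! The estimate extrapolates from itself. Write S = T_V and U = T_{pV}. Since V is the convex
combination of 0 and pV with weights 1 - 1/p and 1/p, Trotter's product formula and Hölder's
inequality for positive operators give S(t)h ≤ (T(t)f)^{1-1/p} (U(t)g)^{1/p} whenever f, g, h ≥ 0
and h ≤ f^{1-1/p} g^{1/p} (`IsEnveloped.perturbedSemigroup_isLogConvexTriple`).

Suppose S(t) has finite 1→∞ norm N and T(t) has 1→∞ norm at most a. Let ‖f‖_1 ≤ 1, f ≥ 0, and let q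
= 2p/(2p-1) be the exponent conjugate to 2p. Then u = S(t)f lies in L_q. The splitting u =
(u^q)^{1-1/p} (u^{q/2})^{1/p} bounds v = S(t)u in L_{2p}, through T from L_1 to L_∞ and U on L_2.
Interpolation between 1→∞ and ∞→∞ takes S(t)v back to L_∞. Altogether ‖S(t)^3‖_{1→∞} ≤ N^{1/p} M^2
a^{1-1/p} (`normFromTo_one_top_cube_le`).

As S(t)^3 = S(3t), a bound D K s^{-ν} improves to D K^{1/p} s^{-ν}, where D is the constant of the
theorem. Iteration sends K^{(1/p)^n} to 1 (`normFromTo_one_top_le_of_le_exp_smul`). The start needs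
some finite constant K, which is available for V ∨ (-k), because its semigroup is dominated by
e^{kt} T(t). The result does not depend on k, and k → ∞ gives the claim
(`normFromTo_top_le_of_tendsto`).

The rest makes T_V tractable: the Trotter formula yields positivity, monotonicity in the potential
and the logarithmic convexity for bounded potentials, and order arguments carry these to unbounded
ones. -/

section C0Semigroup

variable {X : Type*} [NormedAddCommGroup X] [NormedSpace ℂ X]

/-! ### Growth, joint continuity and bounded perturbation of C₀-semigroups -/

namespace IsC0Semigroup

variable {T S : ℝ≥0 → X →L[ℂ] X}

lemma add_apply (hT : IsC0Semigroup T) (s t : ℝ≥0) (f : X) : T (s + t) f = T s (T t f) := by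
  rw [hT.add]; rfl

lemma zero_apply (hT : IsC0Semigroup T) (f : X) : T 0 f = f := by
  rw [hT.zero]; rfl

lemma nsmul (hT : IsC0Semigroup T) (n : ℕ) (t : ℝ≥0) : T (n * t) = T t ^ n := by
  induction n with
  | zero => simp [hT.zero]
  | succ k ih => rw [Nat.cast_succ, add_mul, one_mul, hT.add, ih, pow_succ]

lemma exists_bound [CompleteSpace X] (hT : IsC0Semigroup T) (τ : ℝ≥0) :
    ∃ C : ℝ, 1 ≤ C ∧ ∀ t ≤ τ, ‖T t‖ ≤ C := by
  obtain ⟨C, hC⟩ := banach_steinhaus (g := fun t : Set.Icc (0 : ℝ≥0) τ => T t) (by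
    intro f
    obtain ⟨C, hC⟩ := (isCompact_Icc (a := (0 : ℝ≥0)) (b := τ)).exists_bound_of_continuousOn
      (hT.continuous f).continuousOn
    exact ⟨C, fun t => hC t t.2⟩)
  exact ⟨max C 1, le_max_right _ _, fun t ht => (hC ⟨t, zero_le, ht⟩).trans (le_max_left _ _)⟩

lemma exists_exp_bound [CompleteSpace X] (hT : IsC0Semigroup T) :
    ∃ C ω : ℝ, 1 ≤ C ∧ 0 ≤ ω ∧ ∀ t : ℝ≥0, ‖T t‖ ≤ C * Real.exp (ω * t) := by
  obtain ⟨C, hC1, hC⟩ := hT.exists_bound 1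
  refine ⟨C, Real.log C, hC1, Real.log_nonneg hC1, fun t => ?_⟩
  have key : ∀ n : ℕ, ∀ s : ℝ≥0, s ≤ 1 → ‖T (n + s)‖ ≤ C * C ^ n := by
    intro n
    induction n with
    | zero => intro s hs; simpa using hC s hs
    | succ k ih =>
      intro s hs
      rw [Nat.cast_succ, add_right_comm, add_comm, hT.add]
      calc ‖T 1 * T (k + s)‖ ≤ ‖T 1‖ * ‖T (k + s)‖ := norm_mul_le _ _
        _ ≤ C * (C * C ^ k) := by
          gcongr
          · exact hC 1 le_rfl
          · exact ih s hs
        _ = C * C ^ (k + 1) := by ring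
  have hfl : ((⌊t⌋₊ : ℝ≥0)) ≤ t := Nat.floor_le zero_le
  have h := key ⌊t⌋₊ (t - ⌊t⌋₊) (by
    rw [tsub_le_iff_left, add_comm]
    rw [add_comm]
    exact (Nat.lt_floor_add_one t).le)
  rw [add_tsub_cancel_of_le hfl] at h
  refine h.trans ?_
  gcongr
  rw [← Real.rpow_natCast, Real.rpow_def_of_pos (by linarith)]
  gcongr
  · exact Real.log_nonneg hC1
  · exact_mod_cast hfl

lemma continuous_uncurry [CompleteSpace X] (hT : IsC0Semigroup T) :
    Continuous fun q : ℝ≥0 × X => T q.1 q.2 := by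
  rw [continuous_iff_continuousAt]
  rintro ⟨t, f⟩
  obtain ⟨C, -, hC⟩ := hT.exists_bound (t + 1)
  have h1 : Tendsto (fun q : ℝ≥0 × X => T q.1 f) (𝓝 (t, f)) (𝓝 (T t f)) :=
    ((hT.continuous f).comp continuous_fst).tendsto _
  have h2 : Tendsto (fun q : ℝ≥0 × X => T q.1 (q.2 - f)) (𝓝 (t, f)) (𝓝 0) := by
    have h3 : Tendsto (fun q : ℝ≥0 × X => C * ‖q.2 - f‖) (𝓝 (t, f)) (𝓝 0) := by
      have : Continuous fun q : ℝ≥0 × X => C * ‖q.2 - f‖ := by fun_prop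
      simpa using this.tendsto (t, f)
    refine squeeze_zero_norm' ?_ h3
    have : ∀ᶠ q : ℝ≥0 × X in 𝓝 (t, f), q.1 < t + 1 :=
      continuous_fst.continuousAt.eventually_lt continuousAt_const (by simp)
    filter_upwards [this] with q hq
    exact (T q.1).le_of_opNorm_le (hC _ hq.le) _
  have := h2.add h1
  simpa [ContinuousAt] using this

lemma rescale (hT : IsC0Semigroup T) (a : ℝ) :
    IsC0Semigroup fun t : ℝ≥0 => (Real.exp (a * t) : ℂ) • T t where
  zero := by simp [hT.zero]
  add s t := by
    rw [hT.add, smul_mul_smul_comm]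
    congr 1
    rw [← Complex.ofReal_mul, ← Real.exp_add]
    push_cast; ring_nf
  continuous f := by
    have := hT.continuous f
    simp only [smul_apply]
    fun_prop

end IsC0Semigroup

/-- `S` satisfies the variation of constants formula for the perturbation of `T` by `B`. -/
def IsMildPerturbation (T : ℝ≥0 → X →L[ℂ] X) (B : X →L[ℂ] X) (S : ℝ≥0 → X →L[ℂ] X) : Prop :=
  ∀ (t : ℝ≥0) (f : X),
    S t f = T t f + ∫ s in (0 : ℝ)..t, T (t - s.toNNReal) (B (S s.toNNReal f))

variable {T S : ℝ≥0 → X →L[ℂ] X}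

lemma IsC0Semigroup.continuous_convolution [CompleteSpace X] (hT : IsC0Semigroup T) (B : X →L[ℂ] X) {u : ℝ≥0 → X}
    (hu : Continuous u) :
    Continuous fun q : ℝ≥0 × ℝ => T (q.1 - q.2.toNNReal) (B (u q.2.toNNReal)) :=
  hT.continuous_uncurry.comp (by fun_prop : Continuous fun q : ℝ≥0 × ℝ =>
    (q.1 - q.2.toNNReal, B (u q.2.toNNReal)))

lemma IsC0Semigroup.intervalIntegrable_convolution [CompleteSpace X] (hT : IsC0Semigroup T) (B : X →L[ℂ] X)
    {u : ℝ≥0 → X} (hu : Continuous u) (t : ℝ≥0) (a b : ℝ) :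
    IntervalIntegrable (fun s : ℝ => T (t - s.toNNReal) (B (u s.toNNReal))) volume a b :=
  Continuous.intervalIntegrable
    ((hT.continuous_convolution B hu).comp (by fun_prop : Continuous fun s : ℝ => (t, s))) _ _

/-- Exponential decay makes the bound uniform in t, so that the Volterra operator acts on bounded
continuous functions on the whole half-line and is a strict contraction there for large κ. -/
lemma IsC0Semigroup.norm_convolution_le {C κ b : ℝ} (hC : 0 ≤ C) (hκ : 0 < κ)
    (hTb : ∀ t : ℝ≥0, ‖T t‖ ≤ C * Real.exp (-κ * t)) (B : X →L[ℂ] X) {u : ℝ≥0 → X}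
    (hub : ∀ s, ‖u s‖ ≤ b) (t : ℝ≥0) :
    ‖∫ s in (0 : ℝ)..t, T (t - s.toNNReal) (B (u s.toNNReal))‖ ≤ C * ‖B‖ / κ * b := by
  have hb : 0 ≤ b := (norm_nonneg _).trans (hub 0)
  have h1 : ∀ s ∈ Set.Ioc (0 : ℝ) t, ‖T (t - s.toNNReal) (B (u s.toNNReal))‖ ≤
      C * ‖B‖ * b * Real.exp (-κ * (t - s)) := by
    intro s hs
    have hs' : s.toNNReal ≤ t := Real.toNNReal_le_iff_le_coe.2 hs.2
    have h2 := hTb (t - s.toNNReal)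
    rw [NNReal.coe_sub hs', Real.coe_toNNReal _ hs.1.le] at h2
    calc _ ≤ ‖T (t - s.toNNReal)‖ * (‖B‖ * ‖u s.toNNReal‖) :=
          (T _).le_opNorm_of_le (B.le_opNorm _)
      _ ≤ (C * Real.exp (-κ * (t - s))) * (‖B‖ * b) := by
          gcongr
          exact hub _
      _ = _ := by ring
  have hd : ∀ s : ℝ, HasDerivAt (fun s : ℝ => Real.exp (-κ * (t - s)) / κ)
      (Real.exp (-κ * (t - s))) s := by
    intro s
    have : HasDerivAt (fun s : ℝ => -κ * (t - s)) κ s := by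
      simpa using ((hasDerivAt_id s).const_sub (t : ℝ)).const_mul (-κ)
    have := this.exp.div_const κ
    rwa [mul_div_assoc, div_self hκ.ne', mul_one] at this
  calc _ ≤ ∫ s in (0 : ℝ)..t, C * ‖B‖ * b * Real.exp (-κ * (t - s)) :=
        intervalIntegral.norm_integral_le_of_norm_le t.2
          (Eventually.of_forall h1) (by
            apply Continuous.intervalIntegrable; fun_prop)
    _ = C * ‖B‖ * b * (Real.exp (-κ * (t - t)) / κ - Real.exp (-κ * (t - 0)) / κ) := by
        rw [intervalIntegral.integral_const_mul, intervalIntegral.integral_eq_sub_of_hasDerivAt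
          (fun s _ => hd s) (by apply Continuous.intervalIntegrable; fun_prop)]
    _ ≤ C * ‖B‖ * b * (1 / κ) := by
        gcongr
        have : 0 ≤ Real.exp (-κ * (t - 0)) / κ := by positivity
        simp only [sub_self, mul_zero, Real.exp_zero]
        linarith
    _ = _ := by ring

variable [CompleteSpace X]

/-- The variation of constants formula reads (1 - K)u = O f, with K the Volterra operator and O f
the orbit of f. As ‖K‖ < 1, a Neumann series inverts 1 - K; evaluation at t then gives bounded
linear operators without further work. -/
lemma IsC0Semigroup.exists_isMildPerturbation_of_decay (hT : IsC0Semigroup T) (B : X →L[ℂ] X)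
    {C κ : ℝ} (hC : 0 ≤ C) (hκ : 0 < κ) (hκB : C * ‖B‖ / κ < 1)
    (hTb : ∀ t : ℝ≥0, ‖T t‖ ≤ C * Real.exp (-κ * t)) :
    ∃ S, IsMildPerturbation T B S ∧ ∀ f, Continuous fun t : ℝ≥0 => S t f := by
  let K : BoundedContinuousFunction ℝ≥0 X →L[ℂ] BoundedContinuousFunction ℝ≥0 X := LinearMap.mkContinuous
    { toFun := fun u => BoundedContinuousFunction.ofNormedAddCommGroup
        (fun t : ℝ≥0 => ∫ s in (0 : ℝ)..t, T (t - s.toNNReal) (B (u s.toNNReal)))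
        (intervalIntegral.continuous_parametric_intervalIntegral_of_continuous
          (hT.continuous_convolution B u.continuous) (by fun_prop))
        (C * ‖B‖ / κ * ‖u‖)
        (IsC0Semigroup.norm_convolution_le hC hκ hTb B u.norm_coe_le_norm)
      map_add' := fun u v => by
        ext t
        simp only [BoundedContinuousFunction.coe_ofNormedAddCommGroup,
          BoundedContinuousFunction.coe_add, Pi.add_apply, map_add]
        exact intervalIntegral.integral_add
          (hT.intervalIntegrable_convolution B u.continuous t _ _)
          (hT.intervalIntegrable_convolution B v.continuous t _ _)
      map_smul' := fun c u => by
        ext t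
        simp [intervalIntegral.integral_smul] }
    (C * ‖B‖ / κ) (fun u => by
      exact BoundedContinuousFunction.norm_ofNormedAddCommGroup_le _ (by positivity)
        (IsC0Semigroup.norm_convolution_le hC hκ hTb B u.norm_coe_le_norm))
  have hK : ‖K‖ < 1 := (LinearMap.mkContinuous_norm_le _ (by positivity) _).trans_lt hκB
  have hT' : ∀ f t, ‖T t f‖ ≤ C * ‖f‖ := fun f t => by
    refine (T t).le_of_opNorm_le ((hTb t).trans ?_) f
    refine mul_le_of_le_one_right hC (Real.exp_le_one_iff.2 ?_)
    have := t.2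
    nlinarith [mul_nonneg hκ.le this]
  let O : X →L[ℂ] BoundedContinuousFunction ℝ≥0 X := LinearMap.mkContinuous
    { toFun := fun f => BoundedContinuousFunction.ofNormedAddCommGroup (fun t => T t f)
        (hT.continuous f) (C * ‖f‖) (hT' f)
      map_add' := fun u v => by ext t; simp
      map_smul' := fun c u => by ext t; simp }
    C (fun f => BoundedContinuousFunction.norm_ofNormedAddCommGroup_le _ (by positivity) (hT' f))
  obtain ⟨Y, hY⟩ : ∃ Y : BoundedContinuousFunction ℝ≥0 X →L[ℂ] BoundedContinuousFunction ℝ≥0 X,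
      (1 - K) * Y = 1 :=
    ⟨((Units.oneSub K hK)⁻¹ : Units _).val, (Units.oneSub K hK).mul_inv⟩
  have hu : ∀ f, Y (O f) = O f + K (Y (O f)) := fun f => by
    have h1 : Y (O f) - K (Y (O f)) = O f := congrArg (fun Z => Z (O f)) hY
    exact sub_eq_iff_eq_add.1 h1
  refine ⟨fun t => (BoundedContinuousFunction.evalCLM ℂ t).comp (Y.comp O), fun t f => ?_,
    fun f => (Y (O f)).continuous⟩
  exact congrArg (fun w : BoundedContinuousFunction ℝ≥0 X => w t) (hu f)

lemma IsC0Semigroup.exists_isMildPerturbation (hT : IsC0Semigroup T) (B : X →L[ℂ] X) :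
    ∃ S, IsMildPerturbation T B S ∧ ∀ f, Continuous fun t : ℝ≥0 => S t f := by
  obtain ⟨C, ω, hC, hω, hb⟩ := hT.exists_exp_bound
  -- Damping T by e^{-(ω+κ)t} leaves the decay rate κ, and this κ makes C‖B‖/κ < 1; the damping is
  -- undone at the end.
  set κ : ℝ := C * ‖B‖ + 1 with hκ
  have hκ0 : 0 < κ := by positivity
  obtain ⟨S, hS, hSc⟩ := (hT.rescale (-(ω + κ))).exists_isMildPerturbation_of_decay B
    (C := C) (κ := κ) (by positivity) hκ0 (by rw [div_lt_one hκ0]; linarith) (by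
      intro t
      rw [norm_smul, Complex.norm_real, Real.norm_of_nonneg (Real.exp_nonneg _)]
      calc _ ≤ Real.exp (-(ω + κ) * t) * (C * Real.exp (ω * t)) := by gcongr; exact hb t
        _ = C * (Real.exp (-(ω + κ) * t) * Real.exp (ω * t)) := by ring
        _ = _ := by rw [← Real.exp_add]; ring_nf)
  refine ⟨fun t => (Real.exp ((ω + κ) * t) : ℂ) • S t, fun t f => ?_, fun f => ?_⟩
  · simp only [smul_apply]
    have he : Real.exp ((ω + κ) * t + -(ω + κ) * t) = 1 := by ring_nf; exact Real.exp_zero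
    rw [hS t f, smul_add, smul_apply, smul_smul, ← Complex.ofReal_mul,
      ← Real.exp_add, ← intervalIntegral.integral_smul]
    congr 1
    · rw [he]; simp
    · refine intervalIntegral.integral_congr fun s hs => ?_
      rw [Set.uIcc_of_le t.coe_nonneg] at hs
      have hs' : s.toNNReal ≤ t := Real.toNNReal_le_iff_le_coe.2 hs.2
      simp only [smul_apply, map_smul, smul_smul, ← Complex.ofReal_mul,
        ← Real.exp_add]
      rw [NNReal.coe_sub hs', Real.coe_toNNReal _ hs.1]
      ring_nf
  · have := hSc f
    simp only [smul_apply]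
    fun_prop

end C0Semigroup

/-! ### Uniqueness, generators and Chernoff's formula -/

section C0Perturbation

variable {X : Type*} [NormedAddCommGroup X] [NormedSpace ℂ X] [CompleteSpace X]
  {T S : ℝ≥0 → X →L[ℂ] X}

/-- Gronwall's inequality, applied to the primitive of ‖w‖ rather than to ‖w‖ itself, since only the
primitive is known to be differentiable. -/
lemma IsC0Semigroup.eq_zero_of_volterra (hT : IsC0Semigroup T) (B : X →L[ℂ] X) {w : ℝ≥0 → X}
    (hwc : Continuous w)
    (hw : ∀ t : ℝ≥0, w t = ∫ s in (0 : ℝ)..t, T (t - s.toNNReal) (B (w s.toNNReal))) (t : ℝ≥0) :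
    w t = 0 := by
  obtain ⟨C, hC1, hC⟩ := hT.exists_bound t
  have hC0 : 0 ≤ C := by linarith
  have hc : Continuous fun s : ℝ => ‖w s.toNNReal‖ := by fun_prop
  have hbound : ∀ x ∈ Set.Icc (0 : ℝ) t,
      ‖w x.toNNReal‖ ≤ C * ‖B‖ * ∫ s in (0 : ℝ)..x, ‖w s.toNNReal‖ := by
    intro x hx
    rw [← intervalIntegral.integral_const_mul]
    nth_rw 1 [hw]
    rw [Real.coe_toNNReal _ hx.1]
    refine intervalIntegral.norm_integral_le_of_norm_le hx.1 (Eventually.of_forall fun s _ => ?_)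
      (Continuous.intervalIntegrable (by fun_prop) _ _)
    calc _ ≤ ‖T (x.toNNReal - s.toNNReal)‖ * (‖B‖ * ‖w s.toNNReal‖) :=
          (T _).le_opNorm_of_le (B.le_opNorm _)
      _ ≤ C * (‖B‖ * ‖w s.toNNReal‖) := by
          gcongr
          exact hC _ (tsub_le_self.trans (Real.toNNReal_le_iff_le_coe.2 hx.2))
      _ = _ := by ring
  have hderiv : ∀ x : ℝ, HasDerivAt (fun x => ∫ s in (0 : ℝ)..x, ‖w s.toNNReal‖)
      ‖w x.toNNReal‖ x := fun x =>
    intervalIntegral.integral_hasDerivAt_right (hc.intervalIntegrable _ _)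
      (hc.stronglyMeasurableAtFilter _ _) hc.continuousAt
  have hg := norm_le_gronwallBound_of_norm_deriv_right_le (a := 0) (b := t) (δ := 0)
    (K := C * ‖B‖) (ε := 0)
    (f := fun x => ∫ s in (0 : ℝ)..x, ‖w s.toNNReal‖) (f' := fun x => ‖w x.toNNReal‖)
    (fun x _ => (hderiv x).continuousAt.continuousWithinAt)
    (fun x _ => (hderiv x).hasDerivWithinAt) (by simp) (fun x hx => by
      rw [norm_norm, add_zero]
      refine (hbound x ⟨hx.1, hx.2.le⟩).trans ?_
      gcongr
      exact le_abs_self _) t ⟨t.2, le_rfl⟩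
  simp only [gronwallBound_ε0_δ0] at hg
  have h0 := hbound t ⟨t.2, le_rfl⟩
  rw [norm_le_zero_iff.1 hg, mul_zero, Real.toNNReal_coe] at h0
  exact norm_le_zero_iff.1 h0

namespace IsMildPerturbation

variable {B : X →L[ℂ] X}

lemma shift (hS : IsMildPerturbation T B S) (hT : IsC0Semigroup T)
    (hc : ∀ f, Continuous fun t : ℝ≥0 => S t f) (t s : ℝ≥0) (f : X) :
    S (t + s) f = T t (S s f) +
      ∫ r in (0 : ℝ)..t, T (t - r.toNNReal) (B (S (r.toNNReal + s) f)) := by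
  have hi := hT.intervalIntegrable_convolution B (hc f) (t + s)
  have h1 : ∫ r in (0 : ℝ)..s, T (t + s - r.toNNReal) (B (S r.toNNReal f)) =
      T t (∫ r in (0 : ℝ)..s, T (s - r.toNNReal) (B (S r.toNNReal f))) := by
    rw [← ContinuousLinearMap.intervalIntegral_comp_comm _
      (hT.intervalIntegrable_convolution B (hc f) s _ _)]
    refine intervalIntegral.integral_congr fun r hr => ?_
    rw [Set.uIcc_of_le s.coe_nonneg] at hr
    have hr' : r.toNNReal ≤ s := Real.toNNReal_le_iff_le_coe.2 hr.2
    rw [add_tsub_assoc_of_le hr', hT.add_apply]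
  have h2 : ∫ r in (s : ℝ)..((t + s : ℝ≥0) : ℝ), T (t + s - r.toNNReal) (B (S r.toNNReal f)) =
      ∫ r in (0 : ℝ)..t, T (t - r.toNNReal) (B (S (r.toNNReal + s) f)) := by
    have := intervalIntegral.integral_comp_add_right (a := 0) (b := t)
      (fun r : ℝ => T (t + s - r.toNNReal) (B (S r.toNNReal f))) (s : ℝ)
    rw [zero_add] at this
    rw [NNReal.coe_add, ← this]
    refine intervalIntegral.integral_congr fun r hr => ?_
    rw [Set.uIcc_of_le t.coe_nonneg] at hr
    rw [Real.toNNReal_add hr.1 s.coe_nonneg, Real.toNNReal_coe, add_tsub_add_eq_tsub_right]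
  rw [hS, ← intervalIntegral.integral_add_adjacent_intervals (hi 0 s) (hi s _), h1, h2, ← add_assoc]
  congr 1
  rw [hS s f, map_add, hT.add_apply]

/-- For fixed s, both t ↦ S(t+s)f and t ↦ S(t)S(s)f solve the same Volterra equation, so their
difference vanishes. -/
lemma isC0Semigroup (hS : IsMildPerturbation T B S) (hT : IsC0Semigroup T)
    (hc : ∀ f, Continuous fun t : ℝ≥0 => S t f) : IsC0Semigroup S where
  zero := by
    ext f
    rw [hS]
    simp [hT.zero]
  add t s := by
    ext f
    have hc1 : Continuous fun t : ℝ≥0 => S (t + s) f :=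
      (hc f).comp (continuous_id.add continuous_const)
    have := hT.eq_zero_of_volterra B (w := fun t => S (t + s) f - S t (S s f))
      (hc1.sub (hc _)) (fun t => by
        rw [hS.shift hT hc, hS t, add_sub_add_left_eq_sub, ← intervalIntegral.integral_sub
          (hT.intervalIntegrable_convolution B hc1 t _ _)
          (hT.intervalIntegrable_convolution B (hc _) t _ _)]
        simp only [map_sub]) t
    exact sub_eq_zero.1 this
  continuous := hc

/-- The quotient is an average of a jointly continuous integrand whose value at the origin is B f.
It holds for every f, not only on the generator's domain; this identifies the generator and also
supplies the consistency in the Trotter formula. -/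
lemma tendsto_diff (hS : IsMildPerturbation T B S) (hT : IsC0Semigroup T)
    (hc : ∀ f, Continuous fun t : ℝ≥0 => S t f) (f : X) :
    Tendsto (fun h : ℝ≥0 => (h : ℝ)⁻¹ • (S h f - T h f)) (𝓝[>] 0) (𝓝 (B f)) := by
  have hS0 := (hS.isC0Semigroup hT hc).zero_apply f
  rw [Metric.tendsto_nhds]
  intro ε hε
  have hcont := (hT.continuous_convolution B (hc f)).continuousAt (x := (0, 0))
  rw [Metric.continuousAt_iff] at hcont
  obtain ⟨δ, hδ, hδ'⟩ := hcont (ε / 2) (by positivity)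
  have hmem : ∀ᶠ h : ℝ≥0 in 𝓝[>] 0, (h : ℝ) < δ := by
    refine (Tendsto.mono_left ?_ nhdsWithin_le_nhds).eventually_lt_const hδ
    exact (NNReal.continuous_coe.tendsto 0)
  filter_upwards [hmem, self_mem_nhdsWithin] with h hh hpos
  have hpos' : (0 : ℝ) < h := hpos
  have hi := hT.intervalIntegrable_convolution B (hc f) h 0 h
  have h1 : (h : ℝ)⁻¹ • (S h f - T h f) - B f = (h : ℝ)⁻¹ •
      ∫ s in (0 : ℝ)..h, (T (h - s.toNNReal) (B (S s.toNNReal f)) - B f) := by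
    rw [intervalIntegral.integral_sub hi intervalIntegrable_const, hS h f, add_sub_cancel_left,
      intervalIntegral.integral_const, sub_zero, smul_sub, smul_smul, inv_mul_cancel₀ hpos'.ne',
      one_smul]
  rw [dist_eq_norm, h1, norm_smul, norm_inv, Real.norm_of_nonneg hpos'.le]
  have h2 : ‖∫ s in (0 : ℝ)..h, (T (h - s.toNNReal) (B (S s.toNNReal f)) - B f)‖ ≤
      ε / 2 * |(h : ℝ) - 0| := by
    refine intervalIntegral.norm_integral_le_of_norm_le_const fun s hs => ?_
    rw [Set.uIoc_of_le hpos'.le] at hs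
    have := hδ' (x := (h, s)) (by
      rw [Prod.dist_eq, max_lt_iff]
      constructor
      · rwa [NNReal.dist_eq, NNReal.coe_zero, sub_zero, abs_of_pos hpos']
      · rw [Real.dist_eq, sub_zero, abs_of_pos hs.1]; exact hs.2.trans_lt hh)
    simp only [Real.toNNReal_zero, tsub_zero, hS0, hT.zero_apply] at this
    rw [dist_eq_norm] at this
    exact this.le
  rw [sub_zero, abs_of_pos hpos'] at h2
  calc _ ≤ (h : ℝ)⁻¹ * (ε / 2 * h) := by gcongr
    _ = ε / 2 := by field_simp
    _ < ε := by linarith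

lemma generatorMapsTo_iff (hS : IsMildPerturbation T B S) (hT : IsC0Semigroup T)
    (hc : ∀ f, Continuous fun t : ℝ≥0 => S t f) (f g : X) :
    GeneratorMapsTo S f g ↔ GeneratorMapsTo T f (g - B f) := by
  have h := hS.tendsto_diff hT hc f
  unfold GeneratorMapsTo
  constructor
  · intro h1
    convert h1.sub h using 2
    rw [← smul_sub]; congr 1; abel
  · intro h1
    convert h1.add h using 2
    · rw [← smul_add]; congr 1; abel
    · abel

end IsMildPerturbation

lemma NNReal.tendsto_coe_nhdsGT_zero : Tendsto ((↑) : ℝ≥0 → ℝ) (𝓝[>] 0) (𝓝[≠] 0) := by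
  refine tendsto_nhdsWithin_iff.2 ⟨(NNReal.continuous_coe.tendsto 0).mono_left nhdsWithin_le_nhds,
    ?_⟩
  filter_upwards [self_mem_nhdsWithin] with h hh
  exact (NNReal.coe_pos.2 hh).ne'

namespace IsC0Semigroup

omit [CompleteSpace X] in
lemma continuous_toNNReal (hT : IsC0Semigroup T) (f : X) :
    Continuous fun s : ℝ => T s.toNNReal f :=
  (hT.continuous f).comp continuous_real_toNNReal

lemma tendsto_average (hT : IsC0Semigroup T) (f : X) (t : ℝ≥0) :
    Tendsto (fun h : ℝ≥0 => (h : ℝ)⁻¹ • ((∫ s in (0 : ℝ)..(t + h), T s.toNNReal f) -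
      ∫ s in (0 : ℝ)..t, T s.toNNReal f)) (𝓝[>] 0) (𝓝 (T t f)) := by
  have hd : HasDerivAt (fun x => ∫ s in (0 : ℝ)..x, T s.toNNReal f) (T (t : ℝ).toNNReal f) t :=
    intervalIntegral.integral_hasDerivAt_right ((hT.continuous_toNNReal f).intervalIntegrable _ _)
      ((hT.continuous_toNNReal f).stronglyMeasurableAtFilter _ _)
      (hT.continuous_toNNReal f).continuousAt
  rw [Real.toNNReal_coe] at hd
  exact (hasDerivAt_iff_tendsto_slope_zero.1 hd).comp NNReal.tendsto_coe_nhdsGT_zero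

lemma generatorMapsTo_integral (hT : IsC0Semigroup T) (f : X) (τ : ℝ≥0) :
    GeneratorMapsTo T (∫ s in (0 : ℝ)..τ, T s.toNNReal f) (T τ f - f) := by
  have hi := fun a b => (hT.continuous_toNNReal f).intervalIntegrable (μ := volume) a b
  have h0 := hT.tendsto_average f 0
  rw [hT.zero_apply] at h0
  refine ((hT.tendsto_average f τ).sub h0).congr fun h => ?_
  rw [← smul_sub]
  congr 1
  have h1 : T h (∫ s in (0 : ℝ)..τ, T s.toNNReal f) =
      ∫ s in (h : ℝ)..(τ + h), T s.toNNReal f := by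
    rw [← ContinuousLinearMap.intervalIntegral_comp_comm _ (hi _ _)]
    have := intervalIntegral.integral_comp_add_right (a := 0) (b := τ)
      (fun r : ℝ => T r.toNNReal f) (h : ℝ)
    rw [zero_add] at this
    rw [← this]
    refine intervalIntegral.integral_congr fun r hr => ?_
    rw [Set.uIcc_of_le τ.coe_nonneg] at hr
    rw [Real.toNNReal_add hr.1 h.coe_nonneg, Real.toNNReal_coe, add_comm, hT.add_apply]
  rw [h1, ← intervalIntegral.integral_interval_sub_left (a := 0) (b := τ + h) (c := h) (hi _ _)
    (hi _ _)]
  simp only [NNReal.coe_zero, zero_add, intervalIntegral.integral_same, sub_zero]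
  abel

lemma dense_generator_domain (hT : IsC0Semigroup T) :
    Dense {f : X | ∃ g, GeneratorMapsTo T f g} := by
  intro f
  have h := hT.tendsto_average f 0
  simp only [NNReal.coe_zero, zero_add, intervalIntegral.integral_same, sub_zero,
    hT.zero_apply] at h
  refine mem_closure_of_tendsto h (Eventually.of_forall fun τ => ?_)
  refine ⟨(τ : ℝ)⁻¹ • (T τ f - f), ?_⟩
  refine ((hT.generatorMapsTo_integral f τ).const_smul ((τ : ℝ)⁻¹)).congr fun h => ?_
  rw [smul_comm, smul_sub, ← ContinuousLinearMap.map_smul_of_tower]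

omit [CompleteSpace X] in
lemma generatorMapsTo_apply (hT : IsC0Semigroup T) {f g : X} (h : GeneratorMapsTo T f g)
    (s : ℝ≥0) : GeneratorMapsTo T (T s f) (T s g) := by
  refine (((T s).continuous.tendsto g).comp h).congr fun t => ?_
  simp only [Function.comp]
  rw [ContinuousLinearMap.map_smul_of_tower, map_sub, ← hT.add_apply, ← hT.add_apply, add_comm]

/-- For f in the domain, s ↦ S(t-s)T(s)f has right derivative zero: its difference quotient at x is
S(t-y) applied to the difference of the quotients of T and S at T(x)f, which have a common limit.
Inclusion of the generators in one direction therefore suffices, by density of the domain. -/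
lemma eq_of_generator (hT : IsC0Semigroup T) (hS : IsC0Semigroup S)
    (h : ∀ f g, GeneratorMapsTo T f g → GeneratorMapsTo S f g) : T = S := by
  funext t
  refine ContinuousLinearMap.coeFn_injective ?_
  refine (T t).continuous.ext_on hT.dense_generator_domain (S t).continuous ?_
  rintro f ⟨g, hfg⟩
  have hcont : Continuous fun s : ℝ => S (t - s.toNNReal) (T s.toNNReal f) :=
    hS.continuous_uncurry.comp ((by fun_prop : Continuous fun s : ℝ => t - s.toNNReal).prodMk
      (hT.continuous_toNNReal f))
  have := constant_of_has_deriv_right_zero (a := 0) (b := t) hcont.continuousOn (fun x hx => by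
    rw [hasDerivWithinAt_iff_tendsto_slope, Set.Ici_sdiff_left]
    set x' := x.toNNReal with hx'
    have h1 := hT.generatorMapsTo_apply hfg x'
    have h2 := Tendsto.sub h1 (h _ _ h1)
    rw [sub_self] at h2
    have hy : Tendsto (fun y : ℝ => (y - x).toNNReal) (𝓝[>] x) (𝓝[>] 0) := by
      refine tendsto_nhdsWithin_iff.2 ⟨?_, ?_⟩
      · have : Continuous fun y : ℝ => (y - x).toNNReal := by fun_prop
        have := this.tendsto x
        rw [sub_self, Real.toNNReal_zero] at this
        exact this.mono_left nhdsWithin_le_nhds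
      · filter_upwards [self_mem_nhdsWithin] with y hy
        exact Real.toNNReal_pos.2 (sub_pos.2 hy)
    have h3 := h2.comp hy
    have h4 : Tendsto (fun y : ℝ => t - y.toNNReal) (𝓝[>] x) (𝓝 (t - x')) :=
      ((by fun_prop : Continuous fun s : ℝ => t - s.toNNReal).tendsto x).mono_left
        nhdsWithin_le_nhds
    have h5 := (hS.continuous_uncurry.tendsto (t - x', 0)).comp (h4.prodMk_nhds h3)
    simp only [map_zero] at h5
    refine h5.congr' ?_
    have hlt : ∀ᶠ y : ℝ in 𝓝[>] x, y < t := nhdsWithin_le_nhds (eventually_lt_nhds hx.2)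
    filter_upwards [self_mem_nhdsWithin, hlt] with y hy hyt
    have hxy : (x : ℝ) < y := hy
    set k := (y - x).toNNReal with hk
    have hyk : y.toNNReal = k + x' := by
      rw [hk, hx', ← Real.toNNReal_add (by linarith) hx.1, sub_add_cancel]
    have hkt : k + x' ≤ t := by rw [← hyk]; exact Real.toNNReal_le_iff_le_coe.2 hyt.le
    have hkr : (k : ℝ) = y - x := Real.coe_toNNReal _ (by linarith)
    have htx : t - x' = (t - (k + x')) + k := by
      have h6 : k ≤ t - x' := le_tsub_of_add_le_right hkt
      rw [add_comm k, ← tsub_tsub, tsub_add_cancel_of_le h6]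
    simp only [Function.comp, slope, vsub_eq_sub, ← hk, ← hx', hkr, hyk]
    rw [htx, hS.add_apply _ k, hT.add_apply k x', ← smul_sub, ContinuousLinearMap.map_smul_of_tower, ← map_sub]
    congr 2
    abel) t ⟨t.2, le_rfl⟩
  simpa [hS.zero_apply, hT.zero_apply] using this

/-- Chernoff's product formula for a family that approximates a `C₀`-semigroup to first order at
every vector. -/
lemma tendsto_pow_of_consistent (hS : IsC0Semigroup S) {F : ℝ≥0 → X →L[ℂ] X} (hF0 : F 0 = 1)
    (t : ℝ≥0) {C : ℝ} (hstab : ∀ n k : ℕ, k ≤ n → ‖F (t / n) ^ k‖ ≤ C)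
    (hcons : ∀ f, Tendsto (fun h : ℝ≥0 => (h : ℝ)⁻¹ • (F h f - S h f)) (𝓝[>] 0) (𝓝 0)) (f : X) :
    Tendsto (fun n : ℕ => (F (t / n) ^ n) f) atTop (𝓝 (S t f)) := by
  rcases eq_or_ne t 0 with rfl | ht
  · simp [hF0, hS.zero]
  have ht0 : 0 < t := pos_iff_ne_zero.2 ht
  have htr : (0 : ℝ) < t := ht0
  have hC : 0 ≤ C := (norm_nonneg _).trans (hstab 0 0 le_rfl)
  have hstep : Tendsto (fun n : ℕ => t / (n : ℝ≥0)) atTop (𝓝[>] 0) := by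
    refine tendsto_nhdsWithin_iff.2 ⟨tendsto_const_div_atTop_nhds_zero_nat t, ?_⟩
    filter_upwards [eventually_gt_atTop 0] with n hn
    exact div_pos ht0 (by exact_mod_cast hn)
  let D : ℕ → X →L[ℂ] X := fun n => ((t / n : ℝ≥0) : ℝ)⁻¹ • (F (t / n) - S (t / n))
  have hD : ∀ g, Tendsto (fun n => D n g) atTop (𝓝 0) := fun g => (hcons g).comp hstep
  -- Consistency at every vector gives a uniform bound on the error quotients; with compactness of
  -- the orbit of f over [0, t] this makes the convergence uniform along the orbit.
  obtain ⟨C', hC'⟩ := banach_steinhaus (g := D) (fun g => by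
    obtain ⟨c, hc⟩ := (hD g).norm.bddAbove_range
    exact ⟨c, fun n => hc ⟨n, rfl⟩⟩)
  have hC'0 : 0 ≤ C' := (norm_nonneg _).trans (hC' 0)
  have huni : ∀ ε > 0, ∀ᶠ n in atTop, ∀ s ≤ t, ‖D n (S s f)‖ ≤ ε := by
    intro ε hε
    have hK := (isCompact_Icc (a := (0 : ℝ≥0)) (b := t)).image (hS.continuous f)
    obtain ⟨A, -, hAfin, hA⟩ := hK.finite_cover_balls (e := ε / (2 * (C' + 1))) (by positivity)
    have hev : ∀ᶠ n in atTop, ∀ g ∈ A, ‖D n g‖ ≤ ε / 2 := by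
      refine (Set.Finite.eventually_all hAfin).2 fun g _ => ?_
      have := (hD g).norm
      rw [norm_zero] at this
      exact this.eventually_le_const (by positivity)
    filter_upwards [hev] with n hn s hs
    obtain ⟨g, hg, hsg⟩ := Set.mem_iUnion₂.1 (hA ⟨s, ⟨zero_le, hs⟩, rfl⟩)
    rw [Metric.mem_ball, dist_eq_norm] at hsg
    calc ‖D n (S s f)‖ = ‖D n (S s f - g) + D n g‖ := by rw [← map_add, sub_add_cancel]
      _ ≤ C' * (ε / (2 * (C' + 1))) + ε / 2 := by
          refine (norm_add_le _ _).trans (add_le_add ?_ (hn g hg))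
          exact ((D n).le_of_opNorm_le (hC' n) _).trans (by gcongr)
      _ ≤ (C' + 1) * (ε / (2 * (C' + 1))) + ε / 2 := by gcongr; linarith
      _ = ε := by field_simp; ring
  rw [Metric.tendsto_nhds]
  intro ε hε
  -- The telescoped error below is at most t C times this quantity; the added 1 keeps the
  -- denominator positive.
  filter_upwards [huni (ε / (2 * (t * C + 1))) (by positivity), eventually_gt_atTop 0]
    with n hn hn0
  set ε' := ε / (2 * (t * C + 1)) with hε'
  set h : ℝ≥0 := t / n with hh
  have hhpos : (0 : ℝ) < h := NNReal.coe_pos.2 (div_pos ht0 (by exact_mod_cast hn0))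
  have hnh : (n : ℝ≥0) * h = t := by rw [hh]; field_simp
  -- Telescoping: exact steps S(h) are exchanged for F(h) one at a time, each exchange costing at
  -- most C h ε'.
  have key : ∀ j ≤ n, ‖(F h ^ j) (S ((n - j : ℕ) * h) f) - S t f‖ ≤ j * (C * (h * ε')) := by
    intro j
    induction j with
    | zero => intro _; simp [hnh]
    | succ j ih =>
      intro hj
      have hs : ((n - (j + 1) : ℕ) : ℝ≥0) * h ≤ t := by
        rw [← hnh]; gcongr; omega
      have e1 : S ((n - j : ℕ) * h) f = S h (S ((n - (j + 1) : ℕ) * h) f) := by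
        rw [← hS.add_apply, show n - j = n - (j + 1) + 1 by omega]
        push_cast; ring_nf
      have e2 : (F h ^ (j + 1)) (S ((n - (j + 1) : ℕ) * h) f) - (F h ^ j) (S ((n - j : ℕ) * h) f)
          = (h : ℝ) • (F h ^ j) (D n (S ((n - (j + 1) : ℕ) * h) f)) := by
        rw [e1, pow_succ, mul_apply_eq_comp, ← map_sub, ← ContinuousLinearMap.map_smul_of_tower]
        congr 1
        change _ = (h : ℝ) • ((h : ℝ)⁻¹ • (F h - S h) _)
        rw [smul_smul, mul_inv_cancel₀ hhpos.ne', one_smul]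
        rfl
      have e3 := ih (by omega)
      calc _ = ‖((F h ^ (j + 1)) (S ((n - (j + 1) : ℕ) * h) f) - (F h ^ j) (S ((n - j : ℕ) * h) f))
            + ((F h ^ j) (S ((n - j : ℕ) * h) f) - S t f)‖ := by congr 1; abel
        _ ≤ h * (C * ε') + j * (C * (h * ε')) := by
          refine (norm_add_le _ _).trans (add_le_add ?_ e3)
          rw [e2, norm_smul, Real.norm_of_nonneg hhpos.le]
          gcongr
          exact ((F h ^ j).le_of_opNorm_le (hstab n j (by omega)) _).trans (by
            gcongr; exact hn _ hs)
        _ = _ := by push_cast; ring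
  have := key n le_rfl
  simp only [Nat.sub_self, Nat.cast_zero, zero_mul, hS.zero_apply] at this
  rw [dist_eq_norm]
  refine this.trans_lt ?_
  have hnr : (n : ℝ) * h = t := by exact_mod_cast hnh
  calc (n : ℝ) * (C * (h * ε')) = (n * h) * C * ε' := by ring
    _ = t * C * ε' := by rw [hnr]
    _ ≤ (t * C + 1) * ε' := by gcongr; linarith
    _ = ε / 2 := by rw [hε']; field_simp
    _ < ε := by linarith

end IsC0Semigroup

end C0Perturbation

/-! ### Order, positive operators and geometric means in complex L₂ -/

section LTwoOrder

open scoped ComplexOrder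

variable {Ω : Type*} [MeasurableSpace Ω] {μ : Measure Ω}

lemma lpTwo_nonneg_iff {f : Lp ℂ 2 μ} :
    0 ≤ f ↔ ∀ᵐ x ∂μ, 0 ≤ (f x).re ∧ (f x).im = 0 := by
  rw [← Lp.coeFn_nonneg]
  refine eventually_congr (Eventually.of_forall fun x => ?_)
  simp only [Pi.zero_apply, Complex.nonneg_iff, eq_comm]

lemma lpTwo_le_iff {f g : Lp ℂ 2 μ} :
    f ≤ g ↔ ∀ᵐ x ∂μ, (f x).re ≤ (g x).re ∧ (f x).im = (g x).im := by
  rw [← Lp.coeFn_le]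
  refine eventually_congr (Eventually.of_forall fun x => ?_)
  simp only [Complex.le_def]

/-- The element of the complex space `L₂` given by a real-valued function. -/
noncomputable def ofRealLpTwo (u : Ω → ℝ) (hu : MemLp u 2 μ) : Lp ℂ 2 μ :=
  (hu.ofReal (K := ℂ)).toLp

lemma coeFn_ofRealLpTwo (u : Ω → ℝ) (hu : MemLp u 2 μ) :
    ofRealLpTwo u hu =ᵐ[μ] fun x => (u x : ℂ) :=
  (hu.ofReal (K := ℂ)).coeFn_toLp

lemma ofRealLpTwo_nonneg {u : Ω → ℝ} (hu : MemLp u 2 μ) (h : ∀ᵐ x ∂μ, 0 ≤ u x) :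
    0 ≤ ofRealLpTwo u hu := by
  rw [lpTwo_nonneg_iff]
  filter_upwards [coeFn_ofRealLpTwo u hu, h] with x hx hux
  simp [hx, hux]

/-- The modulus of an element of `L₂`. -/
noncomputable def lpTwoAbs (f : Lp ℂ 2 μ) : Lp ℂ 2 μ := ofRealLpTwo _ (Lp.memLp f).norm

lemma coeFn_lpTwoAbs (f : Lp ℂ 2 μ) : lpTwoAbs f =ᵐ[μ] fun x => ((‖f x‖ : ℝ) : ℂ) :=
  coeFn_ofRealLpTwo _ _

lemma lpTwoAbs_nonneg (f : Lp ℂ 2 μ) : 0 ≤ lpTwoAbs f :=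
  ofRealLpTwo_nonneg _ (Eventually.of_forall fun _ => norm_nonneg _)

lemma norm_lpTwoAbs (f : Lp ℂ 2 μ) : ‖lpTwoAbs f‖ = ‖f‖ := by
  refine le_antisymm ?_ ?_ <;> refine Lp.norm_le_norm_of_ae_le ?_ <;>
  filter_upwards [coeFn_lpTwoAbs f] with x hx <;> simp [hx]

lemma lpTwo_norm_mono {f g : Lp ℂ 2 μ} (hf : 0 ≤ f) (hfg : f ≤ g) : ‖f‖ ≤ ‖g‖ := by
  refine Lp.norm_le_norm_of_ae_le ?_
  filter_upwards [lpTwo_nonneg_iff.1 hf, lpTwo_le_iff.1 hfg] with x h1 h2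
  have e1 : f x = ((f x).re : ℂ) := Complex.ext rfl (by simp [h1.2])
  have e2 : g x = ((g x).re : ℂ) := Complex.ext rfl (by simp [← h2.2, h1.2])
  rw [e1, e2, Complex.norm_real, Complex.norm_real, Real.norm_of_nonneg h1.1,
    Real.norm_of_nonneg (h1.1.trans h2.1)]
  exact h2.1

lemma lpTwo_smul_nonneg {c : ℝ} (hc : 0 ≤ c) {f : Lp ℂ 2 μ} (hf : 0 ≤ f) : 0 ≤ c • f := by
  rw [lpTwo_nonneg_iff] at hf ⊢
  filter_upwards [hf, Lp.coeFn_smul c f] with x h1 h2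
  simp only [h2, Pi.smul_apply, Complex.smul_re, Complex.smul_im, h1.2, smul_zero, and_true]
  exact mul_nonneg hc h1.1

/-- An element with real values is a difference of nonnegative ones. -/
lemma exists_nonneg_sub_of_im_eq_zero {f : Lp ℂ 2 μ} (hf : ∀ᵐ x ∂μ, (f x).im = 0) :
    ∃ g h : Lp ℂ 2 μ, 0 ≤ g ∧ 0 ≤ h ∧ f = g - h := by
  refine ⟨lpTwoAbs f, lpTwoAbs f - f, lpTwoAbs_nonneg f, ?_, by abel⟩
  rw [lpTwo_nonneg_iff]
  filter_upwards [Lp.coeFn_sub (lpTwoAbs f) f, coeFn_lpTwoAbs f, hf] with x h1 h2 h3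
  rw [h1, Pi.sub_apply, h2]
  simp [h3, Complex.re_le_norm]

lemma exists_re_im_decomposition (f : Lp ℂ 2 μ) :
    ∃ u v : Lp ℂ 2 μ, (u =ᵐ[μ] fun x => ((f x).re : ℂ)) ∧ (v =ᵐ[μ] fun x => ((f x).im : ℂ)) ∧
      f = u + Complex.I • v := by
  refine ⟨ofRealLpTwo _ (Lp.memLp f).re, ofRealLpTwo _ (Lp.memLp f).im, coeFn_ofRealLpTwo _ _,
    coeFn_ofRealLpTwo _ _, ?_⟩
  refine Lp.ext ?_
  filter_upwards [Lp.coeFn_add (ofRealLpTwo _ (Lp.memLp f).re)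
    (Complex.I • ofRealLpTwo _ (Lp.memLp f).im), coeFn_ofRealLpTwo _ (Lp.memLp f).re,
    coeFn_ofRealLpTwo _ (Lp.memLp f).im,
    Lp.coeFn_smul Complex.I (ofRealLpTwo _ (Lp.memLp f).im)] with x h1 h2 h3 h4
  rw [h1, Pi.add_apply, h2, h4, Pi.smul_apply, h3, smul_eq_mul, mul_comm]
  exact (Complex.re_add_im _).symm

lemma lpTwo_induction_nonneg {P : Lp ℂ 2 μ → Prop} (h0 : ∀ f, 0 ≤ f → P f)
    (hadd : ∀ f g, P f → P g → P (f + g)) (hsmul : ∀ (c : ℂ) f, P f → P (c • f))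
    (f : Lp ℂ 2 μ) : P f := by
  have hreal : ∀ u : Lp ℂ 2 μ, (∀ᵐ x ∂μ, (u x).im = 0) → P u := fun u hu => by
    obtain ⟨g, h, hg, hh, rfl⟩ := exists_nonneg_sub_of_im_eq_zero hu
    have := hadd _ _ (h0 g hg) (hsmul (-1) _ (h0 h hh))
    rwa [neg_one_smul, ← sub_eq_add_neg] at this
  obtain ⟨u, v, hu, hv, rfl⟩ := exists_re_im_decomposition f
  exact hadd _ _ (hreal u (hu.mono fun x hx => by simp [hx]))
    (hsmul _ _ (hreal v (hv.mono fun x hx => by simp [hx])))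

lemma lpTwo_re_inner_nonneg {f g : Lp ℂ 2 μ} (hf : 0 ≤ f) (hg : 0 ≤ g) :
    0 ≤ RCLike.re (inner ℂ f g) := by
  rw [L2.inner_def, ← integral_re (L2.integrable_inner f g)]
  refine integral_nonneg_of_ae ?_
  filter_upwards [lpTwo_nonneg_iff.1 hf, lpTwo_nonneg_iff.1 hg] with x h1 h2
  simp [h1.2, h2.2, mul_nonneg h2.1 h1.1]

/-- Expand ‖(f - g) + g‖² and drop the cross term, which is an inner product of nonnegative
elements. -/
lemma lpTwo_norm_sub_sq_le {f g : Lp ℂ 2 μ} (hg : 0 ≤ g) (hgf : g ≤ f) :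
    ‖f - g‖ ^ 2 ≤ ‖f‖ ^ 2 - ‖g‖ ^ 2 := by
  have h1 := norm_add_sq (𝕜 := ℂ) (f - g) g
  have h2 := lpTwo_re_inner_nonneg (sub_nonneg.2 hgf) hg
  rw [sub_add_cancel] at h1
  linarith

/-- Once ‖u i‖² is within ε² of its infimum, `lpTwo_norm_sub_sq_le` bounds the distance to all later
terms by ε. -/
lemma exists_tendsto_of_antitone_nonneg {ι : Type*} [SemilatticeSup ι] [Nonempty ι]
    {u : ι → Lp ℂ 2 μ} (hu : Antitone u) (h0 : ∀ i, 0 ≤ u i) :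
    ∃ g, Tendsto u atTop (𝓝 g) := by
  refine cauchySeq_tendsto_of_complete (Metric.cauchySeq_iff'.2 fun ε hε => ?_)
  have hbdd : BddBelow (Set.range fun i => ‖u i‖ ^ 2) :=
    ⟨0, by rintro _ ⟨i, rfl⟩; positivity⟩
  obtain ⟨i, hi⟩ := exists_lt_of_ciInf_lt
    (show ⨅ i, ‖u i‖ ^ 2 < (⨅ i, ‖u i‖ ^ 2) + ε ^ 2 by linarith [pow_pos hε 2])
  refine ⟨i, fun j hj => ?_⟩
  rw [dist_comm, dist_eq_norm]
  have h1 := lpTwo_norm_sub_sq_le (h0 j) (hu hj)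
  have h2 := ciInf_le hbdd j
  exact lt_of_pow_lt_pow_left₀ 2 hε.le (by linarith)

lemma exists_tendsto_of_monotone_le {ι : Type*} [SemilatticeSup ι] [Nonempty ι]
    {u : ι → Lp ℂ 2 μ} (hu : Monotone u) {g : Lp ℂ 2 μ} (hg : ∀ i, u i ≤ g) :
    ∃ h, Tendsto u atTop (𝓝 h) := by
  obtain ⟨h, hh⟩ := exists_tendsto_of_antitone_nonneg (u := fun i => g - u i)
    (fun i j hij => sub_le_sub_left (hu hij) g) (fun i => sub_nonneg.2 (hg i))
  exact ⟨g - h, by simpa using hh.const_sub g⟩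

/-- Positivity of an operator on `L₂`. -/
def IsPosOp (B : Lp ℂ 2 μ →L[ℂ] Lp ℂ 2 μ) : Prop := ∀ f, 0 ≤ f → 0 ≤ B f

/-- The order of operators on `L₂` given by the cone of positive operators. -/
def PosOpLE (A B : Lp ℂ 2 μ →L[ℂ] Lp ℂ 2 μ) : Prop := ∀ f, 0 ≤ f → A f ≤ B f

variable {A B C D : Lp ℂ 2 μ →L[ℂ] Lp ℂ 2 μ}

lemma IsPosOp.mono (hB : IsPosOp B) {f g : Lp ℂ 2 μ} (h : f ≤ g) : B f ≤ B g := by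
  have := hB _ (sub_nonneg.2 h)
  rwa [map_sub, sub_nonneg] at this

lemma IsPosOp.one : IsPosOp (1 : Lp ℂ 2 μ →L[ℂ] Lp ℂ 2 μ) := fun _ h => h

lemma IsPosOp.mul (hA : IsPosOp A) (hB : IsPosOp B) : IsPosOp (A * B) :=
  fun f hf => hA _ (hB f hf)

lemma IsPosOp.pow (hA : IsPosOp A) (n : ℕ) : IsPosOp (A ^ n) := by
  induction n with
  | zero => exact IsPosOp.one
  | succ n ih => rw [pow_succ]; exact ih.mul hA

lemma PosOpLE.refl (A : Lp ℂ 2 μ →L[ℂ] Lp ℂ 2 μ) : PosOpLE A A := fun _ _ => le_rfl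

lemma PosOpLE.trans (h1 : PosOpLE A B) (h2 : PosOpLE B C) : PosOpLE A C :=
  fun f hf => (h1 f hf).trans (h2 f hf)

lemma PosOpLE.isPosOp (h : PosOpLE A B) (hA : IsPosOp A) : IsPosOp B :=
  fun f hf => (hA f hf).trans (h f hf)

lemma PosOpLE.mul (h1 : PosOpLE A B) (h2 : PosOpLE C D) (hA : IsPosOp A) (hC : IsPosOp C) :
    PosOpLE (A * C) (B * D) :=
  fun f hf => (hA.mono (h2 f hf)).trans (h1 _ ((h2.isPosOp hC) f hf))

lemma PosOpLE.pow (h : PosOpLE A B) (hA : IsPosOp A) (n : ℕ) : PosOpLE (A ^ n) (B ^ n) := by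
  induction n with
  | zero => exact PosOpLE.refl _
  | succ n ih => rw [pow_succ, pow_succ]; exact ih.mul h (hA.pow n) hA

/-- Induction on P'^{n+1} - P^{n+1} = P'(P'^n - P^n) + (P' - P)P^n, comparing the factors of the two
positive products one by one. -/
lemma PosOpLE.pow_sub_pow {A A' B B' : Lp ℂ 2 μ →L[ℂ] Lp ℂ 2 μ} (hA : IsPosOp A)
    (hAA' : PosOpLE A A') (hAB : PosOpLE A B) (hAB' : PosOpLE A' B')
    (hd : PosOpLE (A' - A) (B' - B)) (n : ℕ) : PosOpLE (A' ^ n - A ^ n) (B' ^ n - B ^ n) := by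
  have hA' := hAA'.isPosOp hA
  induction n with
  | zero => simpa using PosOpLE.refl _
  | succ n ih =>
    intro f hf
    have e : ∀ P P' : Lp ℂ 2 μ →L[ℂ] Lp ℂ 2 μ, (P' ^ (n + 1) - P ^ (n + 1)) f =
        P' ((P' ^ n - P ^ n) f) + (P' - P) ((P ^ n) f) := fun P P' => by
      rw [pow_succ' P', pow_succ' P]
      simp only [sub_apply, mul_apply_eq_comp, map_sub]
      abel
    rw [e, e]
    refine add_le_add ?_ ?_
    · have h0 : 0 ≤ (A' ^ n - A ^ n) f := sub_nonneg.2 (hAA'.pow hA n f hf)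
      exact (hAB' _ h0).trans ((hAB'.isPosOp hA').mono (ih f hf))
    · have h0 : IsPosOp (A' - A) := fun g hg => sub_nonneg.2 (hAA' g hg)
      exact (h0.mono (hAB.pow hA n f hf)).trans (hd _ ((hAB.isPosOp hA).pow n f hf))

lemma IsPosOp.im_apply_eq_zero (hB : IsPosOp B) {f : Lp ℂ 2 μ} (hf : ∀ᵐ x ∂μ, (f x).im = 0) :
    ∀ᵐ x ∂μ, (B f x).im = 0 := by
  obtain ⟨g, h, hg, hh, rfl⟩ := exists_nonneg_sub_of_im_eq_zero hf
  rw [map_sub]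
  filter_upwards [lpTwo_nonneg_iff.1 (hB g hg), lpTwo_nonneg_iff.1 (hB h hh),
    Lp.coeFn_sub (B g) (B h)] with x h1 h2 h3
  rw [h3, Pi.sub_apply, Complex.sub_im, h1.2, h2.2, sub_zero]

lemma IsPosOp.re_apply_le (hB : IsPosOp B) {f g : Lp ℂ 2 μ} (hg : 0 ≤ g)
    (h : ∀ᵐ x ∂μ, (f x).re ≤ (g x).re) : ∀ᵐ x ∂μ, (B f x).re ≤ (B g x).re := by
  obtain ⟨u, v, hu, hv, hf⟩ := exists_re_im_decomposition f
  have hug : u ≤ g := by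
    rw [lpTwo_le_iff]
    filter_upwards [hu, h, lpTwo_nonneg_iff.1 hg] with x h1 h2 h3
    simp [h1, h2, h3.2]
  have h4 : B f = B u + Complex.I • B v := by
    conv_lhs => rw [hf]
    rw [map_add, map_smul]
  filter_upwards [lpTwo_le_iff.1 (hB.mono hug), Lp.coeFn_add (B u) (Complex.I • B v),
    Lp.coeFn_smul Complex.I (B v),
    hB.im_apply_eq_zero (f := v) (hv.mono fun x hx => by simp [hx])] with x h1 h2 h3 h5
  rw [h4, h2, Pi.add_apply, h3, Pi.smul_apply]
  simpa [h5] using h1.1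

/-- The modulus inequality for positive operators on complex `L₂`. -/
lemma IsPosOp.norm_apply_le (hB : IsPosOp B) {f g : Lp ℂ 2 μ} (hg : 0 ≤ g)
    (h : ∀ᵐ x ∂μ, ‖f x‖ ≤ (g x).re) : ∀ᵐ x ∂μ, ‖B f x‖ ≤ (B g x).re := by
  -- Linearity reduces the modulus to real parts of multiples zf. The null set depends on z, hence
  -- the passage through a countable dense set; the choice of z as the conjugate of B f x then gives
  -- the modulus.
  have key : ∀ z : ℂ, ∀ᵐ x ∂μ, (z * B f x).re ≤ ‖z‖ * (B g x).re := fun z => by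
    have h1 := hB.re_apply_le (f := z • f) (g := ‖z‖ • g) (lpTwo_smul_nonneg (norm_nonneg z) hg) (by
      filter_upwards [h, Lp.coeFn_smul z f, Lp.coeFn_smul ‖z‖ g] with x h2 h3 h4
      rw [h3, h4, Pi.smul_apply, Pi.smul_apply, smul_eq_mul, Complex.smul_re, smul_eq_mul]
      refine (Complex.re_le_norm _).trans ?_
      rw [norm_mul]
      gcongr)
    rw [map_smul, ContinuousLinearMap.map_smul_of_tower] at h1
    filter_upwards [h1, Lp.coeFn_smul z (B f), Lp.coeFn_smul ‖z‖ (B g)] with x h2 h3 h4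
    rwa [h3, h4, Pi.smul_apply, Pi.smul_apply, smul_eq_mul, Complex.smul_re, smul_eq_mul] at h2
  have h1 := ae_all_iff.2 fun n => key (TopologicalSpace.denseSeq ℂ n)
  filter_upwards [h1, lpTwo_nonneg_iff.1 (hB g hg)] with x hx h0
  have h2 : ∀ z : ℂ, (z * B f x).re ≤ ‖z‖ * (B g x).re := by
    have hcl : IsClosed {z : ℂ | (z * B f x).re ≤ ‖z‖ * (B g x).re} :=
      isClosed_le (by fun_prop) (by fun_prop)
    intro z
    exact hcl.closure_subset_iff.2 (by rintro _ ⟨n, rfl⟩; exact hx n)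
      (TopologicalSpace.denseRange_denseSeq ℂ z)
  rcases eq_or_ne (B f x) 0 with h3 | h3
  · rw [h3, norm_zero]; exact h0.1
  · have h4 := h2 (starRingEnd ℂ (B f x))
    rw [← Complex.normSq_eq_conj_mul_self, Complex.ofReal_re, RCLike.norm_conj,
      Complex.normSq_eq_norm_sq, sq] at h4
    exact le_of_mul_le_mul_left h4 (norm_pos_iff.2 h3)

lemma IsPosOp.norm_apply_le_abs (hB : IsPosOp B) (f : Lp ℂ 2 μ) :
    ∀ᵐ x ∂μ, ‖B f x‖ ≤ (B (lpTwoAbs f) x).re :=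
  hB.norm_apply_le (lpTwoAbs_nonneg f) ((coeFn_lpTwoAbs f).mono fun x hx => by simp [hx])

lemma PosOpLE.norm_le (h : PosOpLE A B) (hA : IsPosOp A) : ‖A‖ ≤ ‖B‖ := by
  refine A.opNorm_le_bound (norm_nonneg _) fun f => ?_
  calc ‖A f‖ ≤ ‖B (lpTwoAbs f)‖ := by
        refine Lp.norm_le_norm_of_ae_le ?_
        filter_upwards [hA.norm_apply_le_abs f, lpTwo_le_iff.1 (h _ (lpTwoAbs_nonneg f))]
          with x h1 h2
        exact h1.trans (h2.1.trans (Complex.re_le_norm _))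
    _ ≤ ‖B‖ * ‖f‖ := by
        rw [← norm_lpTwoAbs f]; exact B.le_opNorm _

/-- `h ≤ f ^ θ * g ^ (1 - θ)` almost everywhere. -/
def GeoMeanLE (θ : ℝ) (h f g : Lp ℂ 2 μ) : Prop :=
  ∀ᵐ x ∂μ, (h x).re ≤ (f x).re ^ θ * (g x).re ^ (1 - θ)

/-- Weighted AM-GM exhibits the geometric mean as an infimum of linear functions of (a, b). Rational
parameters suffice by continuity, so that the criterion can be used almost everywhere. In the
converse, a and b are shifted by ε > 0 so that the optimal parameter log((b+ε)/(a+ε)) exists. -/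
lemma Real.le_rpow_mul_rpow_iff {θ a b c : ℝ} (h0 : 0 < θ) (h1 : θ < 1) (ha : 0 ≤ a)
    (hb : 0 ≤ b) : c ≤ a ^ θ * b ^ (1 - θ) ↔ ∀ q : ℚ,
      c ≤ θ * Real.exp ((1 - θ) * q) * a + (1 - θ) * Real.exp (-θ * q) * b := by
  constructor
  · intro h q
    refine h.trans ?_
    have := Real.geom_mean_le_arith_mean2_weighted (w₁ := θ) (w₂ := 1 - θ)
      (p₁ := Real.exp ((1 - θ) * q) * a) (p₂ := Real.exp (-θ * q) * b) h0.le (by linarith)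
      (by positivity) (by positivity) (by ring)
    rw [Real.mul_rpow (by positivity) ha, Real.mul_rpow (by positivity) hb, ← Real.exp_mul,
      ← Real.exp_mul] at this
    calc a ^ θ * b ^ (1 - θ) = Real.exp ((1 - θ) * q * θ + -θ * q * (1 - θ)) *
          (a ^ θ * b ^ (1 - θ)) := by
          rw [show (1 - θ) * (q : ℝ) * θ + -θ * q * (1 - θ) = 0 by ring, Real.exp_zero, one_mul]
      _ ≤ _ := by
          rw [Real.exp_add]
          calc _ = _ := by ring
            _ ≤ _ := this
            _ = _ := by ring
  · intro h
    have hr : ∀ r : ℝ, c ≤ θ * Real.exp ((1 - θ) * r) * a + (1 - θ) * Real.exp (-θ * r) * b := by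
      have hcl : IsClosed {r : ℝ | c ≤ θ * Real.exp ((1 - θ) * r) * a +
        (1 - θ) * Real.exp (-θ * r) * b} := isClosed_le (by fun_prop) (by fun_prop)
      intro r
      exact hcl.closure_subset_iff.2 (by rintro _ ⟨n, rfl⟩; exact h n) (Rat.denseRange_cast r)
    have hε : ∀ ε : ℝ, 0 < ε → c ≤ (a + ε) ^ θ * (b + ε) ^ (1 - θ) := by
      intro ε hε
      set x := Real.log (a + ε) with hx
      set y := Real.log (b + ε) with hy
      have hax : a + ε = Real.exp x := (Real.exp_log (by linarith)).symm
      have hby : b + ε = Real.exp y := (Real.exp_log (by linarith)).symm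
      have h2 := hr (y - x)
      have h3 : θ * Real.exp ((1 - θ) * (y - x)) * a ≤
          θ * Real.exp ((1 - θ) * (y - x)) * Real.exp x := by
        gcongr; linarith
      have h4 : (1 - θ) * Real.exp (-θ * (y - x)) * b ≤
          (1 - θ) * Real.exp (-θ * (y - x)) * Real.exp y := by
        have : 0 ≤ 1 - θ := by linarith
        gcongr; linarith
      rw [mul_assoc θ _ (Real.exp x), ← Real.exp_add] at h3
      rw [mul_assoc (1 - θ) _ (Real.exp y), ← Real.exp_add] at h4
      rw [hax, hby, ← Real.exp_mul, ← Real.exp_mul, ← Real.exp_add]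
      rw [show (1 - θ) * (y - x) + x = x * θ + y * (1 - θ) by ring] at h3
      rw [show -θ * (y - x) + y = x * θ + y * (1 - θ) by ring] at h4
      linarith
    have hlim : Tendsto (fun ε : ℝ => (a + ε) ^ θ * (b + ε) ^ (1 - θ)) (𝓝[>] 0)
        (𝓝 (a ^ θ * b ^ (1 - θ))) := by
      have hc : Continuous fun ε : ℝ => (a + ε) ^ θ * (b + ε) ^ (1 - θ) :=
        ((by fun_prop : Continuous fun ε : ℝ => a + ε).rpow_const fun _ => Or.inr h0.le).mul
        ((by fun_prop : Continuous fun ε : ℝ => b + ε).rpow_const fun _ => Or.inr (by linarith))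
      have := hc.tendsto 0
      simp only [add_zero] at this
      exact this.mono_left nhdsWithin_le_nhds
    exact ge_of_tendsto hlim (by filter_upwards [self_mem_nhdsWithin] with ε h using hε ε h)

lemma geoMeanLE_iff {θ : ℝ} (h0 : 0 < θ) (h1 : θ < 1) {h f g : Lp ℂ 2 μ} (hh : 0 ≤ h)
    (hf : 0 ≤ f) (hg : 0 ≤ g) : GeoMeanLE θ h f g ↔ ∀ q : ℚ,
      h ≤ (θ * Real.exp ((1 - θ) * q)) • f + ((1 - θ) * Real.exp (-θ * q)) • g := by
  have e : GeoMeanLE θ h f g ↔ ∀ᵐ x ∂μ, ∀ q : ℚ, (h x).re ≤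
      θ * Real.exp ((1 - θ) * q) * (f x).re + (1 - θ) * Real.exp (-θ * q) * (g x).re := by
    refine eventually_congr ?_
    filter_upwards [lpTwo_nonneg_iff.1 hf, lpTwo_nonneg_iff.1 hg] with x h2 h3
    exact Real.le_rpow_mul_rpow_iff h0 h1 h2.1 h3.1
  rw [e, ae_all_iff]
  refine forall_congr' fun q => ?_
  rw [lpTwo_le_iff]
  refine eventually_congr ?_
  filter_upwards [lpTwo_nonneg_iff.1 hf, lpTwo_nonneg_iff.1 hg, lpTwo_nonneg_iff.1 hh,
    Lp.coeFn_add ((θ * Real.exp ((1 - θ) * q)) • f) (((1 - θ) * Real.exp (-θ * q)) • g),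
    Lp.coeFn_smul (θ * Real.exp ((1 - θ) * q)) f,
    Lp.coeFn_smul ((1 - θ) * Real.exp (-θ * q)) g] with x h2 h3 h4 h5 h6 h7
  rw [h5, Pi.add_apply, h6, h7, Pi.smul_apply, Pi.smul_apply]
  simp only [Complex.add_re, Complex.add_im, Complex.smul_re, Complex.smul_im, h2.2, h3.2, h4.2,
    smul_eq_mul, mul_zero, add_zero, and_true]

/-- Hölder's inequality for a positive operator: by `geoMeanLE_iff` the hypothesis is a family of
linear inequalities, and B preserves each of them. -/
lemma IsPosOp.geoMeanLE (hB : IsPosOp B) {θ : ℝ} (h0 : 0 < θ) (h1 : θ < 1) {h f g : Lp ℂ 2 μ}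
    (hh : 0 ≤ h) (hf : 0 ≤ f) (hg : 0 ≤ g) (hgeo : GeoMeanLE θ h f g) :
    GeoMeanLE θ (B h) (B f) (B g) := by
  rw [geoMeanLE_iff h0 h1 hh hf hg] at hgeo
  rw [geoMeanLE_iff h0 h1 (hB h hh) (hB f hf) (hB g hg)]
  intro q
  have := hB.mono (hgeo q)
  rwa [map_add, ContinuousLinearMap.map_smul_of_tower,
    ContinuousLinearMap.map_smul_of_tower] at this

/-- `P h ≤ (P₀ f) ^ θ (P₁ g) ^ (1 - θ)` whenever `h ≤ f ^ θ g ^ (1 - θ)`. -/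
def IsLogConvexTriple (θ : ℝ) (P P₀ P₁ : Lp ℂ 2 μ →L[ℂ] Lp ℂ 2 μ) : Prop :=
  ∀ h f g : Lp ℂ 2 μ, 0 ≤ h → 0 ≤ f → 0 ≤ g → GeoMeanLE θ h f g →
    GeoMeanLE θ (P h) (P₀ f) (P₁ g)

lemma IsLogConvexTriple.mul {θ : ℝ} {P P₀ P₁ Q Q₀ Q₁ : Lp ℂ 2 μ →L[ℂ] Lp ℂ 2 μ}
    (h1 : IsLogConvexTriple θ P P₀ P₁) (h2 : IsLogConvexTriple θ Q Q₀ Q₁) (hQ : IsPosOp Q)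
    (hQ0 : IsPosOp Q₀) (hQ1 : IsPosOp Q₁) :
    IsLogConvexTriple θ (P * Q) (P₀ * Q₀) (P₁ * Q₁) :=
  fun h f g hh hf hg hgeo => h1 _ _ _ (hQ h hh) (hQ0 f hf) (hQ1 g hg) (h2 h f g hh hf hg hgeo)

lemma IsLogConvexTriple.pow {θ : ℝ} {P P₀ P₁ : Lp ℂ 2 μ →L[ℂ] Lp ℂ 2 μ}
    (h : IsLogConvexTriple θ P P₀ P₁) (hP : IsPosOp P) (hP0 : IsPosOp P₀) (hP1 : IsPosOp P₁)
    (n : ℕ) : IsLogConvexTriple θ (P ^ n) (P₀ ^ n) (P₁ ^ n) := by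
  induction n with
  | zero => exact fun h f g _ _ _ hgeo => hgeo
  | succ n ih => simp only [pow_succ]; exact ih.mul h hP hP0 hP1

section Limits

variable {ι : Type*} {l : Filter ι} [l.NeBot] {a b c d : ι → Lp ℂ 2 μ →L[ℂ] Lp ℂ 2 μ}

lemma IsPosOp.of_tendsto (ha : ∀ f, Tendsto (fun i => a i f) l (𝓝 (A f)))
    (h : ∀ᶠ i in l, IsPosOp (a i)) : IsPosOp A :=
  fun f hf => ge_of_tendsto (ha f) (h.mono fun _ hi => hi f hf)

lemma PosOpLE.of_tendsto (ha : ∀ f, Tendsto (fun i => a i f) l (𝓝 (A f)))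
    (hb : ∀ f, Tendsto (fun i => b i f) l (𝓝 (B f))) (h : ∀ᶠ i in l, PosOpLE (a i) (b i)) :
    PosOpLE A B :=
  fun f hf => le_of_tendsto_of_tendsto (ha f) (hb f) (h.mono fun _ hi => hi f hf)

/-- In its linearised form the inequality is closed under norm limits of vectors, so no almost
everywhere convergence is needed. -/
lemma IsLogConvexTriple.of_tendsto {θ : ℝ} (h0 : 0 < θ) (h1 : θ < 1)
    (ha : ∀ f, Tendsto (fun i => a i f) l (𝓝 (A f)))
    (hb : ∀ f, Tendsto (fun i => b i f) l (𝓝 (B f)))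
    (hc : ∀ f, Tendsto (fun i => c i f) l (𝓝 (C f)))
    (hpa : ∀ᶠ i in l, IsPosOp (a i)) (hpb : ∀ᶠ i in l, IsPosOp (b i))
    (hpc : ∀ᶠ i in l, IsPosOp (c i))
    (h : ∀ᶠ i in l, IsLogConvexTriple θ (a i) (b i) (c i)) : IsLogConvexTriple θ A B C := by
  intro u f g hu hf hg hgeo
  rw [geoMeanLE_iff h0 h1 (IsPosOp.of_tendsto ha hpa u hu) (IsPosOp.of_tendsto hb hpb f hf)
    (IsPosOp.of_tendsto hc hpc g hg)]
  intro q
  refine le_of_tendsto_of_tendsto (ha u) (((hb f).const_smul _).add ((hc g).const_smul _)) ?_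
  filter_upwards [h, hpa, hpb, hpc] with i hi hai hbi hci
  exact (geoMeanLE_iff h0 h1 (hai u hu) (hbi f hf) (hci g hg)).1 (hi u f g hu hf hg hgeo) q

end Limits

end LTwoOrder

/-! ### Bounded potentials and the Trotter product -/

section BoundedPotential

open scoped ComplexOrder

variable {Ω : Type*} [MeasurableSpace Ω] {μ : Measure Ω}

/-- A bounded measurable potential. -/
structure IsBddMeasurable (W : Ω → ℝ) : Prop where
  measurable : Measurable W
  bounded : ∃ b : ℝ, ∀ x, |W x| ≤ b

namespace IsBddMeasurable

variable {W Y : Ω → ℝ}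

lemma add (hW : IsBddMeasurable W) (hY : IsBddMeasurable Y) :
    IsBddMeasurable fun x => W x + Y x := by
  obtain ⟨b, hb⟩ := hW.bounded
  obtain ⟨c, hc⟩ := hY.bounded
  exact ⟨hW.measurable.add hY.measurable, b + c,
    fun x => (abs_add_le _ _).trans (add_le_add (hb x) (hc x))⟩

lemma const_mul (hW : IsBddMeasurable W) (r : ℝ) : IsBddMeasurable fun x => r * W x := by
  obtain ⟨b, hb⟩ := hW.bounded
  exact ⟨hW.measurable.const_mul r, |r| * b, fun x => by
    rw [abs_mul]; exact mul_le_mul_of_nonneg_left (hb x) (abs_nonneg _)⟩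

lemma exp (hW : IsBddMeasurable W) : IsBddMeasurable fun x => Real.exp (W x) := by
  obtain ⟨b, hb⟩ := hW.bounded
  exact ⟨hW.measurable.exp, Real.exp b, fun x => by
    rw [Real.abs_exp]; exact Real.exp_le_exp.2 ((le_abs_self _).trans (hb x))⟩

end IsBddMeasurable

variable (μ) in
open Classical in
/-- The operator of multiplication by a bounded measurable function. -/
noncomputable def mulOp (m : Ω → ℝ) : Lp ℂ 2 μ →L[ℂ] Lp ℂ 2 μ :=
  if h : MemLp (fun x => (m x : ℂ)) ∞ μ then
    ContinuousLinearMap.holderL μ ∞ 2 2 (ContinuousLinearMap.mul ℂ ℂ) h.toLp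
  else 0

lemma coeFn_mulOp {m : Ω → ℝ} (hm : IsBddMeasurable m) (f : Lp ℂ 2 μ) :
    mulOp μ m f =ᵐ[μ] fun x => (m x : ℂ) * f x := by
  obtain ⟨b, hb⟩ := hm.bounded
  have h : MemLp (fun x => (m x : ℂ)) ∞ μ :=
    memLp_top_of_bound (Complex.measurable_ofReal.comp hm.measurable).aestronglyMeasurable b
      (Eventually.of_forall fun x => by simpa using hb x)
  rw [mulOp, dif_pos h]
  have h1 := ContinuousLinearMap.coeFn_holder (r := 2) (ContinuousLinearMap.mul ℂ ℂ) h.toLp f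
  filter_upwards [h1, h.coeFn_toLp] with x h2 h3
  rw [ContinuousLinearMap.holderL_apply_apply, h2, h3]
  rfl

lemma mulOp_isPosOp {m : Ω → ℝ} (hm : IsBddMeasurable m) (h0 : ∀ x, 0 ≤ m x) :
    IsPosOp (mulOp μ m) := by
  intro f hf
  rw [lpTwo_nonneg_iff] at hf ⊢
  filter_upwards [hf, coeFn_mulOp hm f] with x h1 h2
  rw [h2, Complex.re_ofReal_mul, Complex.im_ofReal_mul, h1.2, mul_zero]
  exact ⟨mul_nonneg (h0 x) h1.1, rfl⟩

lemma mulOp_sub_le_sub {m m' n n' : Ω → ℝ} (hm : IsBddMeasurable m) (hm' : IsBddMeasurable m')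
    (hn : IsBddMeasurable n) (hn' : IsBddMeasurable n')
    (h : ∀ x, m' x - m x ≤ n' x - n x) :
    PosOpLE (mulOp μ m' - mulOp μ m) (mulOp μ n' - mulOp μ n) := by
  intro f hf
  rw [lpTwo_nonneg_iff] at hf
  rw [sub_apply, sub_apply, lpTwo_le_iff]
  filter_upwards [hf, coeFn_mulOp hm f, coeFn_mulOp hm' f, coeFn_mulOp hn f, coeFn_mulOp hn' f,
    Lp.coeFn_sub (mulOp μ m' f) (mulOp μ m f), Lp.coeFn_sub (mulOp μ n' f) (mulOp μ n f)]
    with x h1 h2 h3 h4 h5 h6 h7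
  rw [h6, h7, Pi.sub_apply, Pi.sub_apply, h2, h3, h4, h5, ← sub_mul, ← sub_mul,
    ← Complex.ofReal_sub, ← Complex.ofReal_sub]
  simp only [Complex.re_ofReal_mul, Complex.im_ofReal_mul, h1.2, mul_zero, and_true]
  exact mul_le_mul_of_nonneg_right (h x) h1.1

lemma mulOp_mono {m n : Ω → ℝ} (hm : IsBddMeasurable m) (hn : IsBddMeasurable n)
    (h : ∀ x, m x ≤ n x) : PosOpLE (mulOp μ m) (mulOp μ n) := by
  intro f hf
  rw [lpTwo_nonneg_iff] at hf
  rw [lpTwo_le_iff]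
  filter_upwards [hf, coeFn_mulOp hm f, coeFn_mulOp hn f] with x h1 h2 h3
  rw [h2, h3]
  simp only [Complex.re_ofReal_mul, Complex.im_ofReal_mul, h1.2, mul_zero, and_true]
  exact mul_le_mul_of_nonneg_right (h x) h1.1

lemma mulOp_le_const {m : Ω → ℝ} (hm : IsBddMeasurable m) {c : ℝ} (h : ∀ x, m x ≤ c) :
    PosOpLE (mulOp μ m) (c • 1) := by
  intro f hf
  rw [lpTwo_nonneg_iff] at hf
  rw [lpTwo_le_iff, smul_apply]
  filter_upwards [hf, coeFn_mulOp hm f, Lp.coeFn_smul c ((1 : Lp ℂ 2 μ →L[ℂ] Lp ℂ 2 μ) f)]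
    with x h1 h2 h3
  rw [h2, h3, Pi.smul_apply]
  simp only [Complex.re_ofReal_mul, Complex.im_ofReal_mul, Complex.smul_re, Complex.smul_im,
    one_apply_eq_self, h1.2, mul_zero, smul_eq_mul, and_true]
  exact mul_le_mul_of_nonneg_right (h x) h1.1

lemma mulOp_isLogConvexTriple {m m₀ m₁ : Ω → ℝ} (hm : IsBddMeasurable m)
    (hm0 : IsBddMeasurable m₀) (hm1 : IsBddMeasurable m₁) {θ : ℝ} (h : ∀ x, 0 ≤ m x)
    (h0 : ∀ x, 0 ≤ m₀ x) (h1 : ∀ x, 0 ≤ m₁ x)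
    (he : ∀ x, m x ≤ m₀ x ^ θ * m₁ x ^ (1 - θ)) :
    IsLogConvexTriple θ (mulOp μ m) (mulOp μ m₀) (mulOp μ m₁) := by
  intro u f g hu hf hg hgeo
  filter_upwards [hgeo, lpTwo_nonneg_iff.1 hf, lpTwo_nonneg_iff.1 hg, lpTwo_nonneg_iff.1 hu,
    coeFn_mulOp hm u, coeFn_mulOp hm0 f, coeFn_mulOp hm1 g] with x h2 h3 h4 h5 h6 h7 h8
  rw [h6, h7, h8, Complex.re_ofReal_mul, Complex.re_ofReal_mul, Complex.re_ofReal_mul,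
    Real.mul_rpow (h0 x) h3.1, Real.mul_rpow (h1 x) h4.1]
  calc m x * (u x).re ≤ (m₀ x ^ θ * m₁ x ^ (1 - θ)) * ((f x).re ^ θ * (g x).re ^ (1 - θ)) :=
        mul_le_mul (he x) h2 h5.1 ((h x).trans (he x))
    _ = _ := by ring

lemma mulOp_exp_tendsto {W : Ω → ℝ} (hW : IsBddMeasurable W) (f : Lp ℂ 2 μ) :
    Tendsto (fun h : ℝ≥0 => (h : ℝ)⁻¹ • (mulOp μ (fun x => Real.exp (-h * W x)) f - f)) (𝓝[>] 0)
      (𝓝 (-mulOp μ W f)) := by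
  obtain ⟨b, hb⟩ := hW.bounded
  rw [tendsto_iff_norm_sub_tendsto_zero]
  have hlim : Tendsto (fun h : ℝ≥0 => (h : ℝ) * b ^ 2 * ‖f‖) (𝓝[>] 0) (𝓝 0) := by
    have : Continuous fun h : ℝ≥0 => (h : ℝ) * b ^ 2 * ‖f‖ := by fun_prop
    have := this.tendsto 0
    simp only [NNReal.coe_zero, zero_mul] at this
    exact this.mono_left nhdsWithin_le_nhds
  have hsmall : ∀ᶠ h : ℝ≥0 in 𝓝[>] 0, (h : ℝ) * b < 1 := by
    have : Continuous fun h : ℝ≥0 => (h : ℝ) * b := by fun_prop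
    have := (this.tendsto 0).mono_left (nhdsWithin_le_nhds (s := Set.Ioi 0))
    refine this.eventually_lt_const ?_
    simp
  refine squeeze_zero' (Eventually.of_forall fun _ => norm_nonneg _) ?_ hlim
  filter_upwards [hsmall, self_mem_nhdsWithin] with h hh hpos
  have hpos' : (0 : ℝ) < h := hpos
  have hexp := (hW.const_mul (-h)).exp
  refine Lp.norm_le_mul_norm_of_ae_le_mul ?_
  filter_upwards [coeFn_mulOp hexp f, coeFn_mulOp hW f,
    Lp.coeFn_sub ((h : ℝ)⁻¹ • (mulOp μ (fun x => Real.exp (-h * W x)) f - f)) (-mulOp μ W f),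
    Lp.coeFn_smul (h : ℝ)⁻¹ (mulOp μ (fun x => Real.exp (-h * W x)) f - f),
    Lp.coeFn_sub (mulOp μ (fun x => Real.exp (-h * W x)) f) f, Lp.coeFn_neg (mulOp μ W f)]
    with x h1 h2 h3 h4 h5 h6
  rw [h3, Pi.sub_apply, h4, Pi.smul_apply, h5, Pi.sub_apply, h6, Pi.neg_apply, h1, h2]
  have e : (h : ℝ)⁻¹ • ((Real.exp (-h * W x) : ℂ) * f x - f x) - -((W x : ℂ) * f x) =
      (((h : ℝ)⁻¹ * (Real.exp (-h * W x) - 1 - -h * W x) : ℝ) : ℂ) * f x := by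
    rw [Complex.real_smul]
    push_cast
    have : (h : ℂ) ≠ 0 := by exact_mod_cast hpos'.ne'
    field_simp
  rw [e, norm_mul, Complex.norm_real, Real.norm_eq_abs, abs_mul, abs_inv, abs_of_pos hpos']
  have h7 : |(-h : ℝ) * W x| ≤ h * b := by
    rw [abs_mul, abs_neg, abs_of_pos hpos']; exact mul_le_mul_of_nonneg_left (hb x) hpos'.le
  have h8 := Real.abs_exp_sub_one_sub_id_le (h7.trans hh.le)
  refine mul_le_mul_of_nonneg_right ?_ (norm_nonneg _)
  calc (h : ℝ)⁻¹ * |Real.exp (-h * W x) - 1 - -h * W x| ≤ (h : ℝ)⁻¹ * (h * b) ^ 2 := by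
        gcongr
        refine h8.trans ?_
        rw [← sq_abs]
        gcongr
    _ = h * b ^ 2 := by field_simp

variable {T : ℝ≥0 → Lp ℂ 2 μ →L[ℂ] Lp ℂ 2 μ} {W Y : Ω → ℝ}

lemma isBoundedPerturbation_unique {S S' : ℝ≥0 → Lp ℂ 2 μ →L[ℂ] Lp ℂ 2 μ}
    (h : IsBoundedPerturbation T W S) (h' : IsBoundedPerturbation T W S') : S = S' :=
  h.1.eq_of_generator h'.1 fun f g hfg => (h'.2 f g).2 ((h.2 f g).1 hfg)

/-- The mild solution has the required generator, and uniqueness identifies it with the semigroup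
picked by choice. -/
lemma boundedPerturbation_spec (hT : IsC0Semigroup T) (hW : IsBddMeasurable W) :
    IsC0Semigroup (boundedPerturbation T W) ∧
      IsMildPerturbation T (-mulOp μ W) (boundedPerturbation T W) := by
  obtain ⟨S, hS, hSc⟩ := hT.exists_isMildPerturbation (-mulOp μ W)
  have hS0 := hS.isC0Semigroup hT hSc
  have hSW : IsBoundedPerturbation T W S := by
    refine ⟨hS0, fun f g => ?_⟩
    rw [hS.generatorMapsTo_iff hT hSc, neg_apply, sub_neg_eq_add]
    constructor
    · intro h
      refine ⟨_, h, ?_⟩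
      filter_upwards [Lp.coeFn_add g (mulOp μ W f), coeFn_mulOp hW f] with x h1 h2
      rw [h1, Pi.add_apply, h2, add_sub_cancel_right]
    · rintro ⟨k, hk, hg⟩
      convert hk
      refine Lp.ext ?_
      filter_upwards [Lp.coeFn_add g (mulOp μ W f), coeFn_mulOp hW f, hg] with x h1 h2 h3
      rw [h1, Pi.add_apply, h2, h3, sub_add_cancel]
  have hex : ∃ S, IsBoundedPerturbation T W S := ⟨S, hSW⟩
  have e : boundedPerturbation T W = S := by
    rw [boundedPerturbation, dif_pos hex]
    exact isBoundedPerturbation_unique hex.choose_spec hSW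
  rw [e]
  exact ⟨hS0, hS⟩

lemma boundedPerturbation_isC0Semigroup (hT : IsC0Semigroup T) (hW : IsBddMeasurable W) :
    IsC0Semigroup (boundedPerturbation T W) := (boundedPerturbation_spec hT hW).1

/-- The factor `T(h) e^{-hW}` of the Trotter product. -/
noncomputable def trotterFactor (T : ℝ≥0 → Lp ℂ 2 μ →L[ℂ] Lp ℂ 2 μ) (W : Ω → ℝ) (h : ℝ≥0) :
    Lp ℂ 2 μ →L[ℂ] Lp ℂ 2 μ :=
  T h * mulOp μ fun x => Real.exp (-h * W x)

lemma trotterFactor_isPosOp (hpos : ∀ t, IsPosOp (T t)) (hW : IsBddMeasurable W) (h : ℝ≥0) :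
    IsPosOp (trotterFactor T W h) :=
  (hpos h).mul (mulOp_isPosOp (hW.const_mul _).exp fun _ => (Real.exp_pos _).le)

/-- Domination of each factor by e^{κh} T(h) provides the stability needed in Chernoff's formula
although T need not be contractive. -/
lemma trotterFactor_pow_le (hT : IsC0Semigroup T) (hpos : ∀ t, IsPosOp (T t))
    (hW : IsBddMeasurable W) {κ : ℝ} (hκ : ∀ x, -κ ≤ W x) (h : ℝ≥0) (n : ℕ) :
    PosOpLE (trotterFactor T W h ^ n) (Real.exp (κ * (n * h : ℝ≥0)) • T (n * h)) := by
  have h1 : PosOpLE (trotterFactor T W h) (Real.exp (κ * h) • T h) := by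
    have h2 := (PosOpLE.refl (T h)).mul (mulOp_le_const (μ := μ) (hW.const_mul (-h)).exp
      (c := Real.exp (κ * h)) (fun x => Real.exp_le_exp.2 (by
        have := mul_le_mul_of_nonneg_right (hκ x) h.coe_nonneg
        linarith))) (hpos h) (mulOp_isPosOp (hW.const_mul _).exp fun _ => (Real.exp_pos _).le)
    rwa [mul_smul_comm, mul_one] at h2
  have h3 := h1.pow (trotterFactor_isPosOp hpos hW h) n
  rwa [smul_pow, ← hT.nsmul, ← Real.exp_nat_mul,
    show (n : ℝ) * (κ * h) = κ * (n * h : ℝ≥0) by push_cast; ring] at h3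

/-- The Trotter product formula. -/
lemma boundedPerturbation_tendsto (hT : IsC0Semigroup T) (hpos : ∀ t, IsPosOp (T t))
    (hW : IsBddMeasurable W) (t : ℝ≥0) (f : Lp ℂ 2 μ) :
    Tendsto (fun n : ℕ => (trotterFactor T W (t / n) ^ n) f) atTop
      (𝓝 (boundedPerturbation T W t f)) := by
  obtain ⟨hS, hmild⟩ := boundedPerturbation_spec hT hW
  obtain ⟨b, hb⟩ := hW.bounded
  obtain ⟨C, hC1, hC⟩ := hT.exists_bound t
  refine hS.tendsto_pow_of_consistent ?_ t (C := Real.exp (|b| * t) * C) (fun n k hkn => ?_)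
    (fun g => ?_) f
  · ext1 g
    refine Lp.ext ?_
    rw [trotterFactor, hT.zero, one_mul]
    filter_upwards [coeFn_mulOp (μ := μ) (hW.const_mul (-(0 : ℝ≥0))).exp g] with x hx
    rw [hx]
    simp
  · have hle : (k : ℝ≥0) * (t / n) ≤ t := by
      rcases Nat.eq_zero_or_pos n with rfl | hn
      · simp
      · have hn' : (0 : ℝ≥0) < n := by exact_mod_cast hn
        calc (k : ℝ≥0) * (t / n) ≤ n * (t / n) := by gcongr
          _ = t := by field_simp
    refine ((trotterFactor_pow_le hT hpos hW (κ := |b|) (fun x => ?_) _ _).norm_le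
      ((trotterFactor_isPosOp hpos hW _).pow k)).trans ?_
    · exact neg_le_of_abs_le ((hb x).trans (le_abs_self b))
    · rw [norm_smul, Real.norm_of_nonneg (Real.exp_nonneg _)]
      gcongr
      exact hC _ hle
  -- The error is T(h)(e^{-hW}g - g) - (S(h)g - T(h)g); divided by h, both terms tend to -Wg.
  · have h1 := mulOp_exp_tendsto hW g
    have h2 := hmild.tendsto_diff hT hS.continuous g
    have hid : Tendsto (fun h : ℝ≥0 => h) (𝓝[>] 0) (𝓝 0) := tendsto_id.mono_left nhdsWithin_le_nhds
    have h3 := (hT.continuous_uncurry.tendsto (0, -mulOp μ W g)).comp (hid.prodMk_nhds h1)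
    rw [hT.zero_apply] at h3
    have h4 := h3.sub h2
    rw [neg_apply, sub_self] at h4
    refine h4.congr fun h => ?_
    simp only [Function.comp, trotterFactor, mul_apply_eq_comp]
    rw [ContinuousLinearMap.map_smul_of_tower]
    refine (smul_sub _ _ _).symm.trans (congrArg _ ?_)
    rw [map_sub]
    abel

lemma boundedPerturbation_isPosOp (hT : IsC0Semigroup T) (hpos : ∀ t, IsPosOp (T t))
    (hW : IsBddMeasurable W) (t : ℝ≥0) : IsPosOp (boundedPerturbation T W t) :=
  IsPosOp.of_tendsto (boundedPerturbation_tendsto hT hpos hW t)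
    (Eventually.of_forall fun n => (trotterFactor_isPosOp hpos hW _).pow n)

lemma trotterFactor_anti (hpos : ∀ t, IsPosOp (T t)) (hW : IsBddMeasurable W)
    (hY : IsBddMeasurable Y) (h : ∀ x, W x ≤ Y x) (t : ℝ≥0) :
    PosOpLE (trotterFactor T Y t) (trotterFactor T W t) :=
  (PosOpLE.refl _).mul (mulOp_mono (hY.const_mul _).exp (hW.const_mul _).exp fun x =>
    Real.exp_le_exp.2 (mul_le_mul_of_nonpos_left (h x) (neg_nonpos.2 t.coe_nonneg))) (hpos t)
    (mulOp_isPosOp (hY.const_mul _).exp fun _ => (Real.exp_pos _).le)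

lemma boundedPerturbation_anti (hT : IsC0Semigroup T) (hpos : ∀ t, IsPosOp (T t))
    (hW : IsBddMeasurable W) (hY : IsBddMeasurable Y) (h : ∀ x, W x ≤ Y x) (t : ℝ≥0) :
    PosOpLE (boundedPerturbation T Y t) (boundedPerturbation T W t) :=
  PosOpLE.of_tendsto (boundedPerturbation_tendsto hT hpos hY t)
    (boundedPerturbation_tendsto hT hpos hW t)
    (Eventually.of_forall fun n => (trotterFactor_anti hpos hW hY h _).pow
      (trotterFactor_isPosOp hpos hY _) n)

lemma boundedPerturbation_le_exp_smul (hT : IsC0Semigroup T) (hpos : ∀ t, IsPosOp (T t))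
    (hW : IsBddMeasurable W) {κ : ℝ} (hκ : ∀ x, -κ ≤ W x) (t : ℝ≥0) :
    PosOpLE (boundedPerturbation T W t) (Real.exp (κ * t) • T t) := by
  refine PosOpLE.of_tendsto (boundedPerturbation_tendsto hT hpos hW t)
    (fun f => tendsto_const_nhds) ?_
  filter_upwards [eventually_gt_atTop 0] with n hn
  have := trotterFactor_pow_le hT hpos hW hκ (t / n) n
  have hn' : (n : ℝ≥0) ≠ 0 := by exact_mod_cast hn.ne'
  rwa [mul_div_cancel₀ t hn'] at this

/-- Absorption damps differences: in the Trotter factors the additional e^{-ha} is at most 1. This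
controls a change of the negative part of a potential uniformly in its positive part. -/
lemma boundedPerturbation_sub_le_sub (hT : IsC0Semigroup T) (hpos : ∀ t, IsPosOp (T t))
    {a : Ω → ℝ} (ha : IsBddMeasurable a) (ha0 : ∀ x, 0 ≤ a x) (hW : IsBddMeasurable W)
    (hY : IsBddMeasurable Y) (h : ∀ x, W x ≤ Y x) (t : ℝ≥0) :
    PosOpLE (boundedPerturbation T (fun x => a x + W x) t -
        boundedPerturbation T (fun x => a x + Y x) t)
      (boundedPerturbation T W t - boundedPerturbation T Y t) := by
  have haW := ha.add hW
  have haY := ha.add hY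
  refine PosOpLE.of_tendsto (l := atTop)
    (a := fun n : ℕ => trotterFactor T (fun x => a x + W x) (t / n) ^ n -
      trotterFactor T (fun x => a x + Y x) (t / n) ^ n)
    (b := fun n : ℕ => trotterFactor T W (t / n) ^ n - trotterFactor T Y (t / n) ^ n)
    (fun f => (boundedPerturbation_tendsto hT hpos haW t f).sub
      (boundedPerturbation_tendsto hT hpos haY t f))
    (fun f => (boundedPerturbation_tendsto hT hpos hW t f).sub
      (boundedPerturbation_tendsto hT hpos hY t f))
    (Eventually.of_forall fun n => ?_)
  have := PosOpLE.pow_sub_pow (trotterFactor_isPosOp hpos haY (t / n))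
    (trotterFactor_anti hpos haW haY (fun x => by linarith [h x]) (t / n))
    (trotterFactor_anti hpos hY haY (fun x => by linarith [ha0 x]) (t / n))
    (trotterFactor_anti hpos hW haW (fun x => by linarith [ha0 x]) (t / n)) ?_ n
  · exact this
  · rw [trotterFactor, trotterFactor, trotterFactor, trotterFactor, ← mul_sub, ← mul_sub]
    refine (PosOpLE.refl _).mul (mulOp_sub_le_sub (haY.const_mul _).exp (haW.const_mul _).exp
      (hY.const_mul _).exp (hW.const_mul _).exp fun x => ?_) (hpos _) ?_
    · simp only [mul_add, Real.exp_add]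
      rw [← mul_sub]
      refine mul_le_of_le_one_left (sub_nonneg.2 (Real.exp_le_exp.2 ?_)) (Real.exp_le_one_iff.2 ?_)
      · exact mul_le_mul_of_nonpos_left (h x) (neg_nonpos.2 (NNReal.coe_nonneg _))
      · exact mul_nonpos_of_nonpos_of_nonneg (neg_nonpos.2 (NNReal.coe_nonneg _)) (ha0 x)
    · intro f hf
      refine sub_nonneg.2 (mulOp_mono (haY.const_mul _).exp (haW.const_mul _).exp (fun x => ?_) f hf)
      exact Real.exp_le_exp.2 (mul_le_mul_of_nonpos_left (by linarith [h x])
        (neg_nonpos.2 (NNReal.coe_nonneg _)))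

/-- T(h) satisfies Hölder's inequality, and the multipliers satisfy e^{-hW} = (e^{-hW₀})^θ
(e^{-hW₁})^{1-θ}; products and strong limits preserve the property. -/
lemma boundedPerturbation_isLogConvexTriple (hT : IsC0Semigroup T) (hpos : ∀ t, IsPosOp (T t))
    {W₀ W₁ : Ω → ℝ} (hW : IsBddMeasurable W) (hW0 : IsBddMeasurable W₀)
    (hW1 : IsBddMeasurable W₁) {θ : ℝ} (h0 : 0 < θ) (h1 : θ < 1)
    (h : ∀ x, W x = θ * W₀ x + (1 - θ) * W₁ x) (t : ℝ≥0) :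
    IsLogConvexTriple θ (boundedPerturbation T W t) (boundedPerturbation T W₀ t)
      (boundedPerturbation T W₁ t) := by
  refine IsLogConvexTriple.of_tendsto h0 h1 (boundedPerturbation_tendsto hT hpos hW t)
    (boundedPerturbation_tendsto hT hpos hW0 t) (boundedPerturbation_tendsto hT hpos hW1 t)
    (Eventually.of_forall fun n => (trotterFactor_isPosOp hpos hW _).pow n)
    (Eventually.of_forall fun n => (trotterFactor_isPosOp hpos hW0 _).pow n)
    (Eventually.of_forall fun n => (trotterFactor_isPosOp hpos hW1 _).pow n)
    (Eventually.of_forall fun n => IsLogConvexTriple.pow ?_ (trotterFactor_isPosOp hpos hW _)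
      (trotterFactor_isPosOp hpos hW0 _) (trotterFactor_isPosOp hpos hW1 _) n)
  refine IsLogConvexTriple.mul
    (fun u f g hu hf hg hgeo => (hpos _).geoMeanLE h0 h1 hu hf hg hgeo)
    (mulOp_isLogConvexTriple (hW.const_mul _).exp (hW0.const_mul _).exp (hW1.const_mul _).exp
      (fun _ => (Real.exp_pos _).le) (fun _ => (Real.exp_pos _).le)
      (fun _ => (Real.exp_pos _).le) fun x => ?_)
    (mulOp_isPosOp (hW.const_mul _).exp fun _ => (Real.exp_pos _).le)
    (mulOp_isPosOp (hW0.const_mul _).exp fun _ => (Real.exp_pos _).le)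
    (mulOp_isPosOp (hW1.const_mul _).exp fun _ => (Real.exp_pos _).le)
  rw [← Real.exp_mul, ← Real.exp_mul, ← Real.exp_add, h x]
  refine le_of_eq (congrArg Real.exp ?_)
  ring

end BoundedPotential

/-! ### Admissible potentials and convergence of their truncations -/

section Admissible

open scoped ComplexOrder

variable {Ω : Type*}

/-- The truncation of `W` to `[-s, r]`. -/
def truncPotential (W : Ω → ℝ) (r s : ℝ) (x : Ω) : ℝ := max (min (W x) r) (-s)

lemma truncPotential_mono {W Y : Ω → ℝ} {x : Ω} (h : W x ≤ Y x) {r r' s s' : ℝ} (hr : r ≤ r')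
    (hs : s' ≤ s) : truncPotential W r s x ≤ truncPotential Y r' s' x :=
  max_le_max (min_le_min h hr) (neg_le_neg hs)

lemma truncPotential_bounds (W : Ω → ℝ) {r s : ℝ} (hr : 0 ≤ r) (hs : 0 ≤ s) (x : Ω) :
    min (W x) 0 ≤ truncPotential W r s x ∧ truncPotential W r s x ≤ max (W x) 0 :=
  ⟨(min_le_min le_rfl hr).trans (le_max_left _ _),
    max_le_max (min_le_left _ _) (neg_nonpos.2 hs)⟩

lemma truncPotential_add (W : Ω → ℝ) {r s : ℝ} (hr : 0 ≤ r) (hs : 0 ≤ s) (x : Ω) :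
    truncPotential W r 0 x + truncPotential W 0 s x = truncPotential W r s x := by
  unfold truncPotential
  rcases le_total (W x) 0 with h | h
  · rw [min_eq_left h, min_eq_left (h.trans hr), neg_zero, max_eq_right h, zero_add]
  · rw [min_eq_right h, neg_zero, max_eq_left (le_min h hr), max_eq_left (neg_nonpos.2 hs),
      max_eq_left ((neg_nonpos.2 hs).trans (le_min h hr)), add_zero]

lemma min_max_eq_truncPotential (W : Ω → ℝ) (n : ℕ) :
    (fun x => min (max (W x) 0) (n : ℝ)) = truncPotential W n 0 := by
  funext x
  rw [truncPotential, neg_zero, max_min_distrib_right, max_eq_left (Nat.cast_nonneg n)]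

lemma max_min_eq_truncPotential (W : Ω → ℝ) (n : ℕ) :
    (fun x => max (min (W x) 0) (-(n : ℝ))) = truncPotential W 0 n := rfl

variable [MeasurableSpace Ω] {μ : Measure Ω}

lemma truncPotential_isBddMeasurable {W : Ω → ℝ} (hW : Measurable W) (r s : ℝ) :
    IsBddMeasurable (truncPotential W r s) := by
  refine ⟨(hW.min measurable_const).max measurable_const, max |r| |s|, fun x => ?_⟩
  unfold truncPotential
  rw [abs_le]
  constructor
  · exact (neg_le_neg (le_max_right _ _)).trans ((neg_le_neg (le_abs_self s)).trans (le_max_right _ _))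
  · exact max_le ((min_le_right _ _).trans ((le_abs_self r).trans (le_max_left _ _)))
      ((neg_le_abs s).trans (le_max_right _ _))

namespace IsC0Semigroup

variable {S U L : ℝ≥0 → Lp ℂ 2 μ →L[ℂ] Lp ℂ 2 μ}

/-- A one-parameter semigroup of operators between two `C₀`-semigroups of positive operators is
strongly continuous. -/
lemma of_sandwich (hU : IsC0Semigroup U) (hL : IsC0Semigroup L) (hU0 : ∀ t, IsPosOp (U t))
    (hUS : ∀ t, PosOpLE (U t) (S t)) (hSL : ∀ t, PosOpLE (S t) (L t)) (hzero : S 0 = 1)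
    (hadd : ∀ s t, S (s + t) = S s * S t) : IsC0Semigroup S where
  zero := hzero
  add := hadd
  continuous f := by
    have h0 : ∀ f : Lp ℂ 2 μ, Tendsto (fun t => S t f) (𝓝 0) (𝓝 f) := by
      refine lpTwo_induction_nonneg (fun f hf => ?_) (fun f g hf hg => ?_) (fun c f hf => ?_)
      · have hUf := (hU.continuous f).tendsto 0
        have hLf := (hL.continuous f).tendsto 0
        rw [hU.zero_apply] at hUf
        rw [hL.zero_apply] at hLf
        have h1 : Tendsto (fun t => S t f - U t f) (𝓝 0) (𝓝 0) := by
          have h2 := (hLf.sub hUf).norm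
          rw [sub_self, norm_zero] at h2
          exact squeeze_zero_norm (fun t => lpTwo_norm_mono (sub_nonneg.2 (hUS t f hf))
            (sub_le_sub_right (hSL t f hf) _)) h2
        simpa using h1.add hUf
      · simpa using hf.add hg
      · simpa using hf.const_smul c
    have hb : ∀ t, ‖S t‖ ≤ ‖L t‖ := fun t => (hSL t).norm_le ((hUS t).isPosOp (hU0 t))
    rw [continuous_iff_continuousAt]
    intro t
    obtain ⟨C, hC1, hC⟩ := hL.exists_bound (t + 1)
    -- With truncated subtraction this sum is |s - t|, which treats both one-sided limits at once.
    have hdist : Tendsto (fun s : ℝ≥0 => (s - t) + (t - s)) (𝓝 t) (𝓝 0) := by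
      have : Continuous fun s : ℝ≥0 => (s - t) + (t - s) := by fun_prop
      simpa using this.tendsto t
    have h1 := (((h0 f).comp hdist).sub_const f).norm.const_mul C
    rw [sub_self, norm_zero, mul_zero] at h1
    rw [ContinuousAt, tendsto_iff_norm_sub_tendsto_zero]
    refine squeeze_zero' (Eventually.of_forall fun _ => norm_nonneg _) ?_ h1
    filter_upwards [eventually_le_nhds (show t < t + 1 by simp)] with s hs
    simp only [Function.comp]
    rcases le_total s t with hst | hst
    · have e : S t f = S s (S (t - s) f) := by
        rw [← mul_apply_eq_comp, ← hadd, add_tsub_cancel_of_le hst]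
      rw [tsub_eq_zero_of_le hst, zero_add, e, norm_sub_rev, ← map_sub]
      exact (S s).le_of_opNorm_le ((hb s).trans (hC s hs)) _
    · have e : S s f = S t (S (s - t) f) := by
        rw [← mul_apply_eq_comp, ← hadd, add_tsub_cancel_of_le hst]
      rw [tsub_eq_zero_of_le hst, add_zero, e, ← map_sub]
      exact (S t).le_of_opNorm_le ((hb t).trans (hC t (by simp))) _

end IsC0Semigroup

lemma tendsto_apply_of_nonneg {ι : Type*} {l : Filter ι} {a : ι → Lp ℂ 2 μ →L[ℂ] Lp ℂ 2 μ}
    {A : Lp ℂ 2 μ →L[ℂ] Lp ℂ 2 μ} (h : ∀ f, 0 ≤ f → Tendsto (fun i => a i f) l (𝓝 (A f)))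
    (f : Lp ℂ 2 μ) : Tendsto (fun i => a i f) l (𝓝 (A f)) := by
  refine lpTwo_induction_nonneg (P := fun f => Tendsto (fun i => a i f) l (𝓝 (A f))) h
    (fun f g hf hg => ?_) (fun c f hf => ?_) f
  · simpa only [map_add] using hf.add hg
  · simpa only [map_smul] using hf.const_smul c

/-- All perturbations of `T` by bounded potentials between `-W⁻` and `W⁺` lie between the
`C₀`-semigroups `U` and `L` of positive operators. -/
structure IsEnveloped (T : ℝ≥0 → Lp ℂ 2 μ →L[ℂ] Lp ℂ 2 μ) (W : Ω → ℝ)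
    (U L : ℝ≥0 → Lp ℂ 2 μ →L[ℂ] Lp ℂ 2 μ) : Prop where
  lower_isC0Semigroup : IsC0Semigroup U
  upper_isC0Semigroup : IsC0Semigroup L
  lower_isPosOp : ∀ t, IsPosOp (U t)
  lower_le : ∀ Y, IsBddMeasurable Y → (∀ x, min (W x) 0 ≤ Y x ∧ Y x ≤ max (W x) 0) →
    ∀ t, PosOpLE (U t) (boundedPerturbation T Y t)
  le_upper : ∀ Y, IsBddMeasurable Y → (∀ x, min (W x) 0 ≤ Y x ∧ Y x ≤ max (W x) 0) →
    ∀ t, PosOpLE (boundedPerturbation T Y t) (L t)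

variable {T U L : ℝ≥0 → Lp ℂ 2 μ →L[ℂ] Lp ℂ 2 μ} {W Y : Ω → ℝ}

lemma IsEnveloped.mono (h : IsEnveloped T W U L)
    (hY : ∀ x, min (W x) 0 ≤ min (Y x) 0 ∧ max (Y x) 0 ≤ max (W x) 0) :
    IsEnveloped T Y U L where
  lower_isC0Semigroup := h.lower_isC0Semigroup
  upper_isC0Semigroup := h.upper_isC0Semigroup
  lower_isPosOp := h.lower_isPosOp
  lower_le Z hZ hZY := h.lower_le Z hZ fun x =>
    ⟨(hY x).1.trans (hZY x).1, (hZY x).2.trans (hY x).2⟩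
  le_upper Z hZ hZY := h.le_upper Z hZ fun x =>
    ⟨(hY x).1.trans (hZY x).1, (hZY x).2.trans (hY x).2⟩

/-- The envelopes are the semigroups of W⁺ (lower) and -W⁻ (upper): a bounded potential between -W⁻
and W⁺ is compared with their truncations at levels above its bound. -/
lemma IsAdmissible.exists_isEnveloped (h : IsAdmissible T W) (hT : IsC0Semigroup T)
    (hpos : ∀ t, IsPosOp (T t)) : ∃ U L, IsEnveloped T W U L := by
  obtain ⟨hW, ⟨U, hU, hUlim⟩, L, hL, hLlim⟩ := h
  simp only [min_max_eq_truncPotential] at hUlim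
  simp only [max_min_eq_truncPotential] at hLlim
  have hb := fun r s => truncPotential_isBddMeasurable hW r s
  refine ⟨U, L, hU, hL, fun t => IsPosOp.of_tendsto (hUlim t)
    (Eventually.of_forall fun n => boundedPerturbation_isPosOp hT hpos (hb _ _) t),
    fun Y hY hYW t => PosOpLE.of_tendsto (hUlim t) (fun f => tendsto_const_nhds) ?_,
    fun Y hY hYW t => PosOpLE.of_tendsto (fun f => tendsto_const_nhds) (hLlim t) ?_⟩
  all_goals
    obtain ⟨b, hYb⟩ := hY.bounded
    filter_upwards [tendsto_natCast_atTop_atTop.eventually_ge_atTop b] with n hn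
  · refine boundedPerturbation_anti hT hpos hY (hb _ _) (fun x => ?_) t
    rw [← min_max_eq_truncPotential]
    exact le_min (hYW x).2 ((le_abs_self _).trans ((hYb x).trans hn))
  · refine boundedPerturbation_anti hT hpos (hb _ _) hY (fun x => ?_) t
    exact max_le (hYW x).1 (neg_le_of_abs_le ((hYb x).trans hn))

lemma IsEnveloped.exists_isStrongLimit (h : IsEnveloped T W U L) (hT : IsC0Semigroup T)
    {Y : ℕ → Ω → ℝ} (hY : ∀ n, IsBddMeasurable (Y n))
    (hYW : ∀ n x, min (W x) 0 ≤ Y n x ∧ Y n x ≤ max (W x) 0)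
    (hlim : ∀ t f, 0 ≤ f → ∃ g, Tendsto (fun n => boundedPerturbation T (Y n) t f) atTop (𝓝 g)) :
    ∃ S, IsC0Semigroup S ∧ IsStrongLimit (fun n => boundedPerturbation T (Y n)) S := by
  have hlim' : ∀ t f, ∃ g, Tendsto (fun n => boundedPerturbation T (Y n) t f) atTop (𝓝 g) := by
    intro t
    refine lpTwo_induction_nonneg (hlim t) ?_ ?_
    · rintro f g ⟨f', hf⟩ ⟨g', hg⟩
      exact ⟨f' + g', by simpa using hf.add hg⟩
    · rintro c f ⟨f', hf⟩
      exact ⟨c • f', by simpa using hf.const_smul c⟩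
  choose G hG using hlim'
  let S : ℝ≥0 → Lp ℂ 2 μ →L[ℂ] Lp ℂ 2 μ := fun t =>
    continuousLinearMapOfTendsto (fun n => boundedPerturbation T (Y n) t)
      (tendsto_pi_nhds.2 (hG t))
  have hS : IsStrongLimit (fun n => boundedPerturbation T (Y n)) S := hG
  have hC0 := fun n => boundedPerturbation_isC0Semigroup hT (hY n)
  have hpos : ∀ n t, IsPosOp (boundedPerturbation T (Y n) t) := fun n t =>
    (h.lower_le _ (hY n) (hYW n) t).isPosOp (h.lower_isPosOp t)
  refine ⟨S, IsC0Semigroup.of_sandwich h.lower_isC0Semigroup h.upper_isC0Semigroup h.lower_isPosOp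
    (fun t => PosOpLE.of_tendsto (fun f => tendsto_const_nhds) (hS t)
      (Eventually.of_forall fun n => h.lower_le _ (hY n) (hYW n) t))
    (fun t => PosOpLE.of_tendsto (hS t) (fun f => tendsto_const_nhds)
      (Eventually.of_forall fun n => h.le_upper _ (hY n) (hYW n) t)) ?_ ?_, hS⟩
  · ext1 f
    refine tendsto_nhds_unique (hS 0 f) ?_
    simp [(hC0 _).zero]
  · intro s t
    ext1 f
    refine tendsto_nhds_unique (hS (s + t) f) ?_
    simp only [(hC0 _).add_apply, mul_apply_eq_comp]
    -- Strong limits pass to products because the operators are bounded by ‖L s‖ uniformly in n.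
    have h1 : Tendsto (fun n => boundedPerturbation T (Y n) s
        (boundedPerturbation T (Y n) t f - S t f)) atTop (𝓝 0) := by
      have h2 := ((hS t f).sub_const (S t f)).norm.const_mul ‖L s‖
      rw [sub_self, norm_zero, mul_zero] at h2
      exact squeeze_zero_norm (fun n => (boundedPerturbation T (Y n) s).le_of_opNorm_le
        ((h.le_upper _ (hY n) (hYW n) s).norm_le (hpos n s)) _) h2
    simpa using h1.add (hS s (S t f))

lemma boundedPerturbation_truncPotential_anti (hT : IsC0Semigroup T) (hpos : ∀ t, IsPosOp (T t))
    (hW : Measurable W) (s : ℝ) (t : ℝ≥0) {f : Lp ℂ 2 μ} (hf : 0 ≤ f) :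
    Antitone fun r => boundedPerturbation T (truncPotential W r s) t f := fun _ _ hr =>
  boundedPerturbation_anti hT hpos (truncPotential_isBddMeasurable hW _ _)
    (truncPotential_isBddMeasurable hW _ _) (fun _ => truncPotential_mono le_rfl hr le_rfl) t f hf

lemma boundedPerturbation_truncPotential_mono (hT : IsC0Semigroup T) (hpos : ∀ t, IsPosOp (T t))
    (hW : Measurable W) (r : ℝ) (t : ℝ≥0) {f : Lp ℂ 2 μ} (hf : 0 ≤ f) :
    Monotone fun s => boundedPerturbation T (truncPotential W r s) t f := fun _ _ hs =>
  boundedPerturbation_anti hT hpos (truncPotential_isBddMeasurable hW _ _)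
    (truncPotential_isBddMeasurable hW _ _) (fun _ => truncPotential_mono le_rfl le_rfl hs) t f hf

namespace IsEnveloped

lemma exists_tendsto_upper (hT : IsC0Semigroup T)
    (hpos : ∀ t, IsPosOp (T t)) (hW : Measurable W) (s : ℝ) (t : ℝ≥0) {f : Lp ℂ 2 μ}
    (hf : 0 ≤ f) :
    ∃ g, Tendsto (fun r => boundedPerturbation T (truncPotential W r s) t f) atTop (𝓝 g) :=
  exists_tendsto_of_antitone_nonneg (boundedPerturbation_truncPotential_anti hT hpos hW s t hf)
    fun _ => boundedPerturbation_isPosOp hT hpos (truncPotential_isBddMeasurable hW _ _) t f hf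

lemma exists_tendsto_lower (h : IsEnveloped T W U L) (hT : IsC0Semigroup T)
    (hpos : ∀ t, IsPosOp (T t)) (hW : Measurable W) (t : ℝ≥0) {f : Lp ℂ 2 μ} (hf : 0 ≤ f) :
    ∃ g, Tendsto (fun s => boundedPerturbation T (truncPotential W 0 s) t f) atTop (𝓝 g) :=
  exists_tendsto_of_monotone_le (boundedPerturbation_truncPotential_mono hT hpos hW 0 t hf)
    (g := L t f) fun s =>
      (boundedPerturbation_truncPotential_mono hT hpos hW 0 t hf (le_max_left s 0)).trans
        (h.le_upper _ (truncPotential_isBddMeasurable hW _ _)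
          (truncPotential_bounds W le_rfl (le_max_right s 0)) t f hf)

/-- The two cutoffs act monotonically in opposite directions, so a joint limit is not automatic. By
`boundedPerturbation_sub_le_sub`, the effect of raising the lower cutoff beyond K is at most its
effect at r = 0, which is small uniformly in r; for the fixed lower cutoff K, the limit in r exists
by monotonicity. -/
lemma exists_tendsto (h : IsEnveloped T W U L) (hT : IsC0Semigroup T)
    (hpos : ∀ t, IsPosOp (T t)) (hW : Measurable W) (t : ℝ≥0) {f : Lp ℂ 2 μ} (hf : 0 ≤ f) :
    ∃ g, Tendsto (fun q : ℝ × ℝ => boundedPerturbation T (truncPotential W q.1 q.2) t f) atTop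
      (𝓝 g) := by
  refine cauchySeq_tendsto_of_complete (Metric.cauchySeq_iff'.2 fun ε hε => ?_)
  obtain ⟨_, hg⟩ := h.exists_tendsto_lower hT hpos hW t hf
  obtain ⟨K₀, hK₀⟩ := Metric.cauchySeq_iff.1 hg.cauchySeq (ε / 2) (by positivity)
  set K := max K₀ 0
  obtain ⟨_, hk⟩ := exists_tendsto_upper hT hpos hW K t hf
  obtain ⟨r₀, hr₀⟩ := Metric.cauchySeq_iff.1 hk.cauchySeq (ε / 2) (by positivity)
  have hK0 : 0 ≤ K := le_max_right _ _
  refine ⟨(max r₀ 0, K), fun q hq => ?_⟩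
  obtain ⟨hq1, hq2⟩ : max r₀ 0 ≤ q.1 ∧ K ≤ q.2 := hq
  have hr0 : 0 ≤ q.1 := (le_max_right _ _).trans hq1
  have hs0 : 0 ≤ q.2 := hK0.trans hq2
  have h4 := boundedPerturbation_sub_le_sub hT hpos (truncPotential_isBddMeasurable hW q.1 0)
    (fun x => by rw [truncPotential, neg_zero]; exact le_max_right _ _)
    (truncPotential_isBddMeasurable hW 0 q.2) (truncPotential_isBddMeasurable hW 0 K)
    (fun x => truncPotential_mono le_rfl le_rfl hq2) t f hf
  rw [funext (truncPotential_add W hr0 hs0), funext (truncPotential_add W hr0 hK0)] at h4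
  have h5 := lpTwo_norm_mono
    (sub_nonneg.2 (boundedPerturbation_truncPotential_mono hT hpos hW q.1 t hf hq2)) h4
  have h6 := hK₀ q.2 ((le_max_left _ _).trans hq2) K (le_max_left _ _)
  have h7 := hr₀ q.1 ((le_max_left _ _).trans hq1) (max r₀ 0) (le_max_left _ _)
  rw [dist_eq_norm] at h6
  refine (dist_triangle _ (boundedPerturbation T (truncPotential W q.1 K) t f) _).trans_lt ?_
  rw [dist_eq_norm]
  have h8 := h5.trans_lt h6
  linarith

lemma isAdmissible (h : IsEnveloped T W U L) (hT : IsC0Semigroup T)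
    (hpos : ∀ t, IsPosOp (T t)) (hW : Measurable W) : IsAdmissible T W := by
  refine ⟨hW, ?_, ?_⟩
  · simp only [min_max_eq_truncPotential]
    refine h.exists_isStrongLimit hT (fun n => truncPotential_isBddMeasurable hW _ _)
      (fun n => truncPotential_bounds W (Nat.cast_nonneg n) le_rfl) fun t f hf => ?_
    obtain ⟨g, hg⟩ := exists_tendsto_upper hT hpos hW 0 t hf
    exact ⟨g, hg.comp tendsto_natCast_atTop_atTop⟩
  · simp only [max_min_eq_truncPotential]
    refine h.exists_isStrongLimit hT (fun n => truncPotential_isBddMeasurable hW _ _)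
      (fun n => truncPotential_bounds W le_rfl (Nat.cast_nonneg n)) fun t f hf => ?_
    obtain ⟨g, hg⟩ := h.exists_tendsto_lower hT hpos hW t hf
    exact ⟨g, hg.comp tendsto_natCast_atTop_atTop⟩

lemma exists_isStrongLimit_truncPotential (h : IsEnveloped T W U L) (hT : IsC0Semigroup T)
    (hpos : ∀ t, IsPosOp (T t)) (hW : Measurable W) :
    ∃ S, IsC0Semigroup S ∧
      (∀ t f, Tendsto (fun n : ℕ => boundedPerturbation T (truncPotential W n n) t f) atTop
        (𝓝 (S t f))) ∧
      ∀ t f, Tendsto (fun q : ℝ × ℝ => boundedPerturbation T (truncPotential W q.1 q.2) t f) atTop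
        (𝓝 (S t f)) := by
  have hseq : Tendsto (fun n : ℕ => ((n : ℝ), (n : ℝ))) atTop atTop := by
    rw [← prod_atTop_atTop_eq]
    exact tendsto_natCast_atTop_atTop.prodMk tendsto_natCast_atTop_atTop
  have hlim : ∀ t f, 0 ≤ f → ∃ g,
      Tendsto (fun n : ℕ => boundedPerturbation T (truncPotential W n n) t f) atTop (𝓝 g) ∧
      Tendsto (fun q : ℝ × ℝ => boundedPerturbation T (truncPotential W q.1 q.2) t f) atTop
        (𝓝 g) := fun t f hf => by
    obtain ⟨g, hg⟩ := h.exists_tendsto hT hpos hW t hf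
    have h1 := hg.comp hseq
    simp only [Function.comp_def] at h1
    exact ⟨g, h1, hg⟩
  obtain ⟨S, hS, hSlim⟩ := h.exists_isStrongLimit hT
    (Y := fun n : ℕ => truncPotential W n n) (fun n => truncPotential_isBddMeasurable hW _ _)
    (fun n => truncPotential_bounds W (Nat.cast_nonneg n) (Nat.cast_nonneg n))
    fun t f hf => (hlim t f hf).imp fun _ hg => hg.1
  refine ⟨S, hS, hSlim, fun t => tendsto_apply_of_nonneg fun f hf => ?_⟩
  obtain ⟨g, hg, hg'⟩ := hlim t f hf
  exact (tendsto_nhds_unique (hSlim t f) hg).symm ▸ hg'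

lemma perturbedSemigroup_spec (h : IsEnveloped T W U L) (hT : IsC0Semigroup T)
    (hpos : ∀ t, IsPosOp (T t)) (hW : Measurable W) :
    IsC0Semigroup (perturbedSemigroup T W) ∧ ∀ t f,
      Tendsto (fun q : ℝ × ℝ => boundedPerturbation T (truncPotential W q.1 q.2) t f) atTop
        (𝓝 (perturbedSemigroup T W t f)) := by
  obtain ⟨S, hS, hSlim, hSlim'⟩ := h.exists_isStrongLimit_truncPotential hT hpos hW
  have hex : ∃ S, IsStrongLimit
      (fun n : ℕ => boundedPerturbation T fun x => max (min (W x) (n : ℝ)) (-(n : ℝ))) S :=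
    ⟨S, hSlim⟩
  have e : perturbedSemigroup T W = S := by
    rw [perturbedSemigroup, dif_pos hex]
    funext t
    ext1 f
    exact tendsto_nhds_unique (hex.choose_spec t f) (hSlim t f)
  rw [e]
  exact ⟨hS, hSlim'⟩

end IsEnveloped

end Admissible

/-! ### Order and convexity properties of T_W -/

section PerturbedSemigroup

open scoped ComplexOrder

lemma truncPotential_const_mul {Ω : Type*} (W : Ω → ℝ) {p : ℝ} (hp : 0 ≤ p) (r s : ℝ) (x : Ω) :
    p * truncPotential W r s x = truncPotential (fun x => p * W x) (p * r) (p * s) x := by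
  rw [truncPotential, truncPotential, mul_max_of_nonneg _ _ hp, mul_min_of_nonneg _ _ hp, mul_neg]

lemma truncPotential_max {Ω : Type*} (W : Ω → ℝ) {k r s : ℝ} (hk : 0 ≤ k) (hr : 0 ≤ r)
    (hs : k ≤ s) :
    truncPotential (fun x => max (W x) (-k)) r s = truncPotential W r k := by
  funext x
  rw [truncPotential, truncPotential, max_min_distrib_right, max_min_distrib_right,
    max_assoc, max_eq_left (neg_le_neg hs), max_eq_left (show -s ≤ r by linarith),
    max_eq_left (show -k ≤ r by linarith)]

variable {Ω : Type*} [MeasurableSpace Ω] {μ : Measure Ω}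
  {T U L U' L' : ℝ≥0 → Lp ℂ 2 μ →L[ℂ] Lp ℂ 2 μ} {W Y : Ω → ℝ}

lemma IsLogConvexTriple.mono {θ : ℝ} (h0 : 0 < θ) (h1 : θ < 1)
    {P P₀ P₁ Q₀ Q₁ : Lp ℂ 2 μ →L[ℂ] Lp ℂ 2 μ} (h : IsLogConvexTriple θ P P₀ P₁)
    (hP0 : IsPosOp P₀) (hP1 : IsPosOp P₁) (hPQ0 : PosOpLE P₀ Q₀) (hPQ1 : PosOpLE P₁ Q₁) :
    IsLogConvexTriple θ P Q₀ Q₁ := by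
  intro u f g hu hf hg hgeo
  filter_upwards [h u f g hu hf hg hgeo, lpTwo_nonneg_iff.1 (hP0 f hf),
    lpTwo_nonneg_iff.1 (hP1 g hg), lpTwo_le_iff.1 (hPQ0 f hf), lpTwo_le_iff.1 (hPQ1 g hg)]
    with x h2 h3 h4 h5 h6
  refine h2.trans (mul_le_mul (Real.rpow_le_rpow h3.1 h5.1 h0.le)
    (Real.rpow_le_rpow h4.1 h6.1 (by linarith)) (Real.rpow_nonneg h4.1 _)
    (Real.rpow_nonneg (h3.1.trans h5.1) _))

namespace IsEnveloped

variable (h : IsEnveloped T W U L) (hT : IsC0Semigroup T) (hpos : ∀ t, IsPosOp (T t))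
  (hW : Measurable W)

include h hT hpos hW

lemma perturbedSemigroup_isPosOp (t : ℝ≥0) : IsPosOp (perturbedSemigroup T W t) :=
  IsPosOp.of_tendsto ((h.perturbedSemigroup_spec hT hpos hW).2 t)
    (Eventually.of_forall fun _ => boundedPerturbation_isPosOp hT hpos
      (truncPotential_isBddMeasurable hW _ _) t)

lemma perturbedSemigroup_anti (h' : IsEnveloped T Y U' L') (hY : Measurable Y)
    (hWY : ∀ x, W x ≤ Y x) (t : ℝ≥0) :
    PosOpLE (perturbedSemigroup T Y t) (perturbedSemigroup T W t) :=
  PosOpLE.of_tendsto ((h'.perturbedSemigroup_spec hT hpos hY).2 t)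
    ((h.perturbedSemigroup_spec hT hpos hW).2 t)
    (Eventually.of_forall fun _ => boundedPerturbation_anti hT hpos
      (truncPotential_isBddMeasurable hW _ _) (truncPotential_isBddMeasurable hY _ _)
      (fun x => truncPotential_mono (hWY x) le_rfl le_rfl) t)

lemma perturbedSemigroup_le_exp_smul {κ : ℝ} (hκ0 : 0 ≤ κ) (hκ : ∀ x, -κ ≤ W x) (t : ℝ≥0) :
    PosOpLE (perturbedSemigroup T W t) (Real.exp (κ * t) • T t) := by
  refine PosOpLE.of_tendsto ((h.perturbedSemigroup_spec hT hpos hW).2 t)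
    (fun f => tendsto_const_nhds) ?_
  filter_upwards [eventually_ge_atTop (0 : ℝ × ℝ)] with q hq
  refine boundedPerturbation_le_exp_smul hT hpos (truncPotential_isBddMeasurable hW _ _)
    (fun x => ?_) t
  exact (le_min (hκ x) (by have : 0 ≤ q.1 := hq.1; linarith)).trans (le_max_left _ _)

lemma perturbedSemigroup_isLogConvexTriple {p : ℝ} (hp : 1 < p)
    (h' : IsEnveloped T (fun x => p * W x) U' L') (t : ℝ≥0) :
    IsLogConvexTriple (1 - 1 / p) (perturbedSemigroup T W t) (T t)
      (perturbedSemigroup T (fun x => p * W x) t) := by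
  have hp0 : 0 < p := by linarith
  have hp1 : 1 / p < 1 := (div_lt_one hp0).2 hp
  have hpp : 0 < 1 / p := by positivity
  have hpW : Measurable fun x => p * W x := hW.const_mul p
  have hz : IsBddMeasurable fun _ : Ω => (0 : ℝ) := ⟨measurable_const, 0, by simp⟩
  -- Truncating W at (r, s) truncates pW at (pr, ps); the joint limit permits such cutoffs off the
  -- integer diagonal.
  have hscale : Tendsto (fun q : ℝ × ℝ => (p * q.1, p * q.2)) atTop atTop := by
    rw [← prod_atTop_atTop_eq]
    exact (tendsto_fst.const_mul_atTop hp0).prodMk (tendsto_snd.const_mul_atTop hp0)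
  have hlim : ∀ f, Tendsto (fun q : ℝ × ℝ =>
      boundedPerturbation T (truncPotential (fun x => p * W x) (p * q.1) (p * q.2)) t f) atTop
      (𝓝 (perturbedSemigroup T (fun x => p * W x) t f)) := fun f => by
    have h1 := ((h'.perturbedSemigroup_spec hT hpos hpW).2 t f).comp hscale
    simp only [Function.comp_def] at h1
    exact h1
  have key : IsLogConvexTriple (1 - 1 / p) (perturbedSemigroup T W t)
      (boundedPerturbation T (fun _ => 0) t) (perturbedSemigroup T (fun x => p * W x) t) := by
    refine IsLogConvexTriple.of_tendsto (by linarith) (by linarith)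
      ((h.perturbedSemigroup_spec hT hpos hW).2 t) (fun f => tendsto_const_nhds) hlim
      (Eventually.of_forall fun _ => boundedPerturbation_isPosOp hT hpos
        (truncPotential_isBddMeasurable hW _ _) t)
      (Eventually.of_forall fun _ => boundedPerturbation_isPosOp hT hpos hz t)
      (Eventually.of_forall fun _ => boundedPerturbation_isPosOp hT hpos
        (truncPotential_isBddMeasurable hpW _ _) t)
      (Eventually.of_forall fun q => boundedPerturbation_isLogConvexTriple hT hpos
        (truncPotential_isBddMeasurable hW _ _) hz (truncPotential_isBddMeasurable hpW _ _)
        (by linarith) (by linarith) (fun x => ?_) t)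
    rw [← truncPotential_const_mul W hp0.le]
    field_simp
    ring
  -- For the zero potential, domination by T(t) is enough; equality is not needed.
  have hle := boundedPerturbation_le_exp_smul hT hpos hz (κ := 0) (by simp) t
  rw [zero_mul, Real.exp_zero, one_smul] at hle
  exact key.mono (by linarith) (by linarith) (boundedPerturbation_isPosOp hT hpos hz t)
    (h'.perturbedSemigroup_isPosOp hT hpos hpW t) hle (PosOpLE.refl _)

/-- For lower cutoffs beyond k, the truncations of W ∨ (-k) are truncations of W with lower cutoff
exactly k, so the joint limit for W controls them uniformly in the upper cutoff. -/
lemma perturbedSemigroup_max_tendsto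
    (hk : ∀ k : ℕ, IsEnveloped T (fun x => max (W x) (-(k : ℝ))) U' L') (t : ℝ≥0)
    (f : Lp ℂ 2 μ) :
    Tendsto (fun k : ℕ => perturbedSemigroup T (fun x => max (W x) (-(k : ℝ))) t f) atTop
      (𝓝 (perturbedSemigroup T W t f)) := by
  have hlim := (h.perturbedSemigroup_spec hT hpos hW).2 t f
  rw [Metric.tendsto_atTop'] at hlim
  rw [Metric.tendsto_atTop]
  intro ε hε
  obtain ⟨⟨R, S⟩, hRS⟩ := hlim (ε / 2) (by positivity)
  obtain ⟨k₀, hk₀⟩ := exists_nat_gt S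
  refine ⟨k₀, fun k hkk => lt_of_le_of_lt ?_ (half_lt_self hε)⟩
  have hkS : S < k := hk₀.trans_le (by exact_mod_cast hkk)
  have h1 := ((hk k).perturbedSemigroup_spec hT hpos (hW.max measurable_const)).2 t f
  refine le_of_tendsto (h1.dist tendsto_const_nhds) ?_
  -- The 1 makes the index strictly larger than (R, S), as `Metric.tendsto_atTop'` demands.
  filter_upwards [eventually_ge_atTop ((max (R + 1) 0, (k : ℝ)) : ℝ × ℝ)] with q hq
  obtain ⟨hq1, hq2⟩ : max (R + 1) 0 ≤ q.1 ∧ (k : ℝ) ≤ q.2 := hq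
  rw [truncPotential_max W (Nat.cast_nonneg k) ((le_max_right _ _).trans hq1) hq2]
  refine (hRS (q.1, (k : ℝ)) ?_).le
  refine Prod.mk_lt_mk.2 (Or.inl ⟨?_, hkS.le⟩)
  have := (le_max_left (R + 1) 0).trans hq1
  linarith

end IsEnveloped

end PerturbedSemigroup

/-! ### Operator norms between L_q-spaces and interpolation -/

section NormFromTo

open scoped ComplexOrder

variable {Ω : Type*} [MeasurableSpace Ω] {μ : Measure Ω}
  {A B : Lp ℂ 2 μ →L[ℂ] Lp ℂ 2 μ}

lemma eLpNorm_lpTwoAbs (f : Lp ℂ 2 μ) (q : ℝ≥0∞) : eLpNorm (lpTwoAbs f) q μ = eLpNorm f q μ :=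
  eLpNorm_congr_norm_ae ((coeFn_lpTwoAbs f).mono fun x hx => by simp [hx])

/-- The modulus inequality reduces to |f|, which has the same L_q-norm as f. -/
lemma normFromTo_mono (hA : IsPosOp A) (h : PosOpLE A B) (q r : ℝ≥0∞) :
    normFromTo q r A ≤ normFromTo q r B := by
  refine iSup₂_le fun f hf => ?_
  refine le_trans ?_ (le_iSup₂_of_le (lpTwoAbs f) ((eLpNorm_lpTwoAbs f q).trans_le hf) le_rfl)
  refine eLpNorm_mono_ae ?_
  filter_upwards [hA.norm_apply_le_abs f, lpTwo_le_iff.1 (h _ (lpTwoAbs_nonneg f))] with x h1 h2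
  exact h1.trans (h2.1.trans (Complex.re_le_norm _))

lemma normFromTo_smul_le (c : ℝ) (q r : ℝ≥0∞) :
    normFromTo q r (c • B) ≤ ‖c‖ₑ * normFromTo q r B := by
  refine iSup₂_le fun f hf => ?_
  rw [smul_apply, eLpNorm_congr_ae (Lp.coeFn_smul c (B f)), eLpNorm_const_smul]
  gcongr
  exact le_iSup₂_of_le f hf le_rfl

lemma eLpNorm_apply_le_of_normFromTo_le {q r : ℝ≥0∞} {C : ℝ}
    (hB : normFromTo q r B ≤ ENNReal.ofReal C) {f : Lp ℂ 2 μ} {a : ℝ} (ha : 0 < a)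
    (hf : eLpNorm f q μ ≤ ENNReal.ofReal a) : eLpNorm (B f) r μ ≤ ENNReal.ofReal (C * a) := by
  have h1 : eLpNorm (a⁻¹ • f : Lp ℂ 2 μ) q μ ≤ 1 := by
    rw [eLpNorm_congr_ae (Lp.coeFn_smul a⁻¹ f), eLpNorm_const_smul,
      Real.enorm_eq_ofReal (by positivity)]
    calc _ ≤ ENNReal.ofReal a⁻¹ * ENNReal.ofReal a := by gcongr
      _ = 1 := by rw [← ENNReal.ofReal_mul (by positivity), inv_mul_cancel₀ ha.ne',
        ENNReal.ofReal_one]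
  have h2 : eLpNorm (B (a⁻¹ • f)) r μ ≤ ENNReal.ofReal C :=
    (le_iSup₂_of_le (f := fun (f : Lp ℂ 2 μ) (_ : eLpNorm f q μ ≤ 1) => eLpNorm (B f) r μ)
      _ h1 le_rfl).trans hB
  have h3 : B f = a • B (a⁻¹ • f) := by
    rw [← ContinuousLinearMap.map_smul_of_tower, smul_smul, mul_inv_cancel₀ ha.ne', one_smul]
  rw [h3, eLpNorm_congr_ae (Lp.coeFn_smul a _), eLpNorm_const_smul,
    Real.enorm_eq_ofReal ha.le, mul_comm C, ENNReal.ofReal_mul ha.le]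
  gcongr

lemma lpTwo_enorm_ae_of_nonneg {f : Lp ℂ 2 μ} (hf : 0 ≤ f) :
    ∀ᵐ x ∂μ, ‖f x‖ₑ = ENNReal.ofReal (f x).re := by
  filter_upwards [lpTwo_nonneg_iff.1 hf] with x hx
  have e1 : f x = ((f x).re : ℂ) := Complex.ext rfl (by simp [hx.2])
  rw [e1, ← ofReal_norm, Complex.norm_real, Real.norm_of_nonneg hx.1, Complex.ofReal_re]

lemma eLpNorm_one_of_nonneg {f : Lp ℂ 2 μ} (hf : 0 ≤ f) :
    eLpNorm f 1 μ = ∫⁻ x, ENNReal.ofReal (f x).re ∂μ := by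
  rw [eLpNorm_one_eq_lintegral_enorm]
  exact lintegral_congr_ae (lpTwo_enorm_ae_of_nonneg hf)

lemma eLpNorm_two_sq_of_nonneg {f : Lp ℂ 2 μ} (hf : 0 ≤ f) :
    eLpNorm f 2 μ ^ 2 = ∫⁻ x, ENNReal.ofReal ((f x).re ^ 2) ∂μ := by
  have h := eLpNorm_nnreal_pow_eq_lintegral (μ := μ) (f := f) (p := 2) two_ne_zero
  have h2 : ((2 : ℝ≥0) : ℝ≥0∞) = 2 := rfl
  have h3 : ((2 : ℝ≥0) : ℝ) = 2 := rfl
  rw [h2, h3, ENNReal.rpow_ofNat] at h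
  rw [h]
  refine lintegral_congr_ae ?_
  filter_upwards [lpTwo_enorm_ae_of_nonneg hf, lpTwo_nonneg_iff.1 hf] with x hx h0
  rw [hx, ENNReal.rpow_ofNat, ENNReal.ofReal_pow h0.1]

lemma ae_norm_le_of_eLpNorm_top_le {f : Lp ℂ 2 μ} {d : ℝ} (hd : 0 ≤ d)
    (h : eLpNorm f ∞ μ ≤ ENNReal.ofReal d) : ∀ᵐ x ∂μ, ‖f x‖ ≤ d := by
  rw [eLpNorm_exponent_top] at h
  filter_upwards [ae_le_eLpNormEssSup (f := f) (μ := μ)] with x hx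
  have := hx.trans h
  rwa [← ofReal_norm, ENNReal.ofReal_le_ofReal_iff hd] at this

lemma eLpNorm_top_le_of_ae_re_le {f : Lp ℂ 2 μ} (hf : 0 ≤ f) {d : ℝ}
    (h : ∀ᵐ x ∂μ, (f x).re ≤ d) : eLpNorm f ∞ μ ≤ ENNReal.ofReal d := by
  rw [eLpNorm_exponent_top]
  refine eLpNormEssSup_le_of_ae_enorm_bound ?_
  filter_upwards [h, lpTwo_enorm_ae_of_nonneg hf] with x h1 h2
  rw [h2]
  exact ENNReal.ofReal_le_ofReal h1

lemma ae_re_apply_le_of_one_top {C J : ℝ} (hC : 0 ≤ C) (hJ : 0 < J)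
    (hB : normFromTo 1 ∞ B ≤ ENNReal.ofReal C) {f : Lp ℂ 2 μ} (hf : 0 ≤ f)
    (h : ∫⁻ x, ENNReal.ofReal (f x).re ∂μ ≤ ENNReal.ofReal J) :
    ∀ᵐ x ∂μ, (B f x).re ≤ C * J := by
  rw [← eLpNorm_one_of_nonneg hf] at h
  filter_upwards [ae_norm_le_of_eLpNorm_top_le (by positivity)
    (eLpNorm_apply_le_of_normFromTo_le hB hJ h)] with x hx
  exact (Complex.re_le_norm _).trans hx

lemma ae_re_apply_le_of_top_top {C d : ℝ} (hC : 0 ≤ C) (hd : 0 < d)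
    (hB : normFromTo ∞ ∞ B ≤ ENNReal.ofReal C) {f : Lp ℂ 2 μ} (hf : 0 ≤ f)
    (h : ∀ᵐ x ∂μ, (f x).re ≤ d) : ∀ᵐ x ∂μ, (B f x).re ≤ C * d := by
  filter_upwards [ae_norm_le_of_eLpNorm_top_le (by positivity)
    (eLpNorm_apply_le_of_normFromTo_le hB hd (eLpNorm_top_le_of_ae_re_le hf h))] with x hx
  exact (Complex.re_le_norm _).trans hx

lemma lintegral_apply_le_of_one_one {C J : ℝ} (hJ : 0 < J) (hBp : IsPosOp B)
    (hB : normFromTo 1 1 B ≤ ENNReal.ofReal C) {f : Lp ℂ 2 μ} (hf : 0 ≤ f)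
    (h : ∫⁻ x, ENNReal.ofReal (f x).re ∂μ ≤ ENNReal.ofReal J) :
    ∫⁻ x, ENNReal.ofReal (B f x).re ∂μ ≤ ENNReal.ofReal (C * J) := by
  rw [← eLpNorm_one_of_nonneg hf] at h
  rw [← eLpNorm_one_of_nonneg (hBp f hf)]
  exact eLpNorm_apply_le_of_normFromTo_le hB hJ h

lemma lintegral_sq_apply_le_of_two_two {C J : ℝ} (hC : 0 ≤ C) (hJ : 0 < J) (hBp : IsPosOp B)
    (hB : normFromTo 2 2 B ≤ ENNReal.ofReal C) {f : Lp ℂ 2 μ} (hf : 0 ≤ f)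
    (h : ∫⁻ x, ENNReal.ofReal ((f x).re ^ 2) ∂μ ≤ ENNReal.ofReal J) :
    ∫⁻ x, ENNReal.ofReal ((B f x).re ^ 2) ∂μ ≤ ENNReal.ofReal (C ^ 2 * J) := by
  rw [← eLpNorm_two_sq_of_nonneg hf, ← Real.sq_sqrt hJ.le,
    ENNReal.ofReal_pow (Real.sqrt_nonneg J)] at h
  have h1 := eLpNorm_apply_le_of_normFromTo_le hB (Real.sqrt_pos.2 hJ)
    ((ENNReal.pow_le_pow_left_iff two_ne_zero).1 h)
  rw [← eLpNorm_two_sq_of_nonneg (hBp f hf)]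
  calc _ ≤ ENNReal.ofReal (C * √J) ^ 2 := by gcongr
    _ = _ := by
      rw [← ENNReal.ofReal_pow (by positivity), mul_pow, Real.sq_sqrt hJ.le]

/-- The power `f ^ s` of a nonnegative element of `L₂`, if it is square integrable. -/
lemma exists_lpTwo_rpow {f : Lp ℂ 2 μ} (hf : 0 ≤ f) {s : ℝ}
    (hfin : ∫⁻ x, ENNReal.ofReal ((f x).re ^ (2 * s)) ∂μ < ∞) :
    ∃ g : Lp ℂ 2 μ, 0 ≤ g ∧ ∀ᵐ x ∂μ, (g x).re = (f x).re ^ s := by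
  have hf0 := lpTwo_nonneg_iff.1 hf
  have hmem : MemLp (fun x => (f x).re ^ s) 2 μ := by
    refine ⟨((Complex.continuous_re.comp_aestronglyMeasurable
      (Lp.aestronglyMeasurable f)).aemeasurable.pow_const s).aestronglyMeasurable, ?_⟩
    rw [eLpNorm_lt_top_iff_lintegral_rpow_enorm_lt_top two_ne_zero ENNReal.ofNat_ne_top]
    refine (lintegral_congr_ae ?_).trans_lt hfin
    filter_upwards [hf0] with x hx
    rw [Real.enorm_eq_ofReal (Real.rpow_nonneg hx.1 s), ENNReal.toReal_ofNat,
      ENNReal.ofReal_rpow_of_nonneg (Real.rpow_nonneg hx.1 s) (by norm_num),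
      ← Real.rpow_mul hx.1, mul_comm s]
  refine ⟨ofRealLpTwo _ hmem, ofRealLpTwo_nonneg _ (hf0.mono fun x hx => Real.rpow_nonneg hx.1 s),
    (coeFn_ofRealLpTwo _ hmem).mono fun x hx => by rw [hx, Complex.ofReal_re]⟩

lemma lintegral_rpow_le {f : Lp ℂ 2 μ} (hf : 0 ≤ f) {N J r s : ℝ} (hN : 0 ≤ N)
    (hfN : ∀ᵐ x ∂μ, (f x).re ≤ N) (hr : 0 ≤ r) (hrs : r ≤ s)
    (hJ : ∫⁻ x, ENNReal.ofReal ((f x).re ^ r) ∂μ ≤ ENNReal.ofReal J) :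
    ∫⁻ x, ENNReal.ofReal ((f x).re ^ s) ∂μ ≤ ENNReal.ofReal (N ^ (s - r) * J) := by
  calc _ ≤ ∫⁻ x, ENNReal.ofReal (N ^ (s - r)) * ENNReal.ofReal ((f x).re ^ r) ∂μ := by
        refine lintegral_mono_ae ?_
        filter_upwards [hfN, lpTwo_nonneg_iff.1 hf] with x h1 h2
        rw [← ENNReal.ofReal_mul (Real.rpow_nonneg hN _)]
        refine ENNReal.ofReal_le_ofReal ?_
        calc (f x).re ^ s = (f x).re ^ (s - r) * (f x).re ^ r := by
              rw [← Real.rpow_add_of_nonneg h2.1 (by linarith) hr, sub_add_cancel]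
          _ ≤ _ := mul_le_mul_of_nonneg_right (Real.rpow_le_rpow h2.1 h1 (by linarith))
              (Real.rpow_nonneg h2.1 r)
    _ = ENNReal.ofReal (N ^ (s - r)) * ∫⁻ x, ENNReal.ofReal ((f x).re ^ r) ∂μ :=
        lintegral_const_mul' _ _ ENNReal.ofReal_ne_top
    _ ≤ ENNReal.ofReal (N ^ (s - r)) * ENNReal.ofReal J := by gcongr
    _ = _ := (ENNReal.ofReal_mul (Real.rpow_nonneg hN _)).symm

/-- A positive operator that is bounded from `L₁` to `L_∞` and on `L_∞` is bounded from `L_r`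
to `L_∞`. -/
lemma ae_re_apply_le_of_lintegral_rpow {r N M J K : ℝ} (hr : 1 < r) (hN : 0 < N) (hM : 0 < M)
    (hJ : 0 < J) (hK : 0 < K) (hB : IsPosOp B) (hBN : normFromTo 1 ∞ B ≤ ENNReal.ofReal N)
    (hBM : normFromTo ∞ ∞ B ≤ ENNReal.ofReal M) {v : Lp ℂ 2 μ} (hv : 0 ≤ v)
    (hvK : ∀ᵐ x ∂μ, (v x).re ≤ K)
    (hvJ : ∫⁻ x, ENNReal.ofReal ((v x).re ^ r) ∂μ ≤ ENNReal.ofReal J) {δ : ℝ} (hδ : 0 < δ) :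
    ∀ᵐ x ∂μ, (B v x).re ≤ (N * J) ^ (1 / r) * M ^ (1 - 1 / r) + M * δ := by
  have hr0 : 0 < r := by linarith
  have hrr : 1 / r < 1 := (div_lt_one hr0).2 hr
  have hrp : 0 < 1 / r := by positivity
  have hv0 := lpTwo_nonneg_iff.1 hv
  obtain ⟨k₁, hk₁, hk₁v⟩ := exists_lpTwo_rpow hv
    ((lintegral_rpow_le hv hK.le hvK hr0.le (by linarith : r ≤ 2 * r) hvJ).trans_lt
      ENNReal.ofReal_lt_top)
  have hmeas : Measurable fun x => (v x).re :=
    Complex.measurable_re.comp (Lp.stronglyMeasurable v).measurable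
  have hE : MeasurableSet {x | δ < (v x).re} := measurableSet_lt measurable_const hmeas
  -- The constant 1 need not lie in L₂, so Hölder's inequality v = (v^r)^{1/r} 1^{1-1/r} is used
  -- only on {v > δ}, whose indicator is at most v/δ. The remaining part of v is at most δ and costs
  -- Mδ.
  have hm2 : MemLp (Set.indicator {x | δ < (v x).re} fun _ => (1 : ℝ)) 2 μ := by
    refine ((Lp.memLp v).re.const_mul δ⁻¹).mono
      (measurable_const.indicator hE).aestronglyMeasurable ?_
    refine Eventually.of_forall fun x => ?_
    by_cases hx : δ < (v x).re
    · rw [Set.indicator_of_mem (by exact hx), norm_one, Real.norm_eq_abs, abs_mul,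
        abs_of_pos (inv_pos.2 hδ)]
      change 1 ≤ δ⁻¹ * |(v x).re|
      rw [abs_of_pos (hδ.trans hx), inv_mul_eq_div, one_le_div hδ]
      exact hx.le
    · rw [Set.indicator_of_notMem (by exact hx), norm_zero]
      exact norm_nonneg _
  have hm3 : MemLp (Set.indicator {x | δ < (v x).re} fun x => (v x).re) 2 μ :=
    (Lp.memLp v).re.indicator hE
  set k₂ := ofRealLpTwo _ hm2 with hk₂
  set k₃ := ofRealLpTwo _ hm3 with hk₃
  have e2 := coeFn_ofRealLpTwo _ hm2
  have e3 := coeFn_ofRealLpTwo _ hm3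
  have e4 := Lp.coeFn_sub v k₃
  have h2 : 0 ≤ k₂ := ofRealLpTwo_nonneg _ (Eventually.of_forall fun x =>
    Set.indicator_nonneg (fun _ _ => zero_le_one) x)
  have h3 : 0 ≤ k₃ := ofRealLpTwo_nonneg _ (hv0.mono fun x hx => by
    by_cases hxE : δ < (v x).re
    · rw [Set.indicator_of_mem (by exact hxE)]; exact hx.1
    · rw [Set.indicator_of_notMem (by exact hxE)])
  have h4' : ∀ᵐ x ∂μ, (0 ≤ ((v - k₃ : Lp ℂ 2 μ) x).re ∧ ((v - k₃ : Lp ℂ 2 μ) x).im = 0) ∧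
      ((v - k₃ : Lp ℂ 2 μ) x).re ≤ δ := by
    filter_upwards [e3, e4, hv0] with x h5 h6 h7
    rw [h6, Pi.sub_apply, h5]
    by_cases hxE : δ < (v x).re
    · rw [Set.indicator_of_mem (by exact hxE)]
      simp [h7.2, hδ.le]
    · rw [Set.indicator_of_notMem (by exact hxE)]
      simpa [h7.2, h7.1] using hxE
  have h4 : 0 ≤ v - k₃ := lpTwo_nonneg_iff.2 (h4'.mono fun _ hx => hx.1)
  have hgeo : GeoMeanLE (1 / r) k₃ k₁ k₂ := by
    filter_upwards [e2, e3, hk₁v, hv0] with x h5 h6 h7 h8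
    rw [h5, h6, h7, Complex.ofReal_re, Complex.ofReal_re, ← Real.rpow_mul h8.1,
      mul_one_div_cancel hr0.ne', Real.rpow_one]
    by_cases hxE : δ < (v x).re
    · rw [Set.indicator_of_mem (by exact hxE), Set.indicator_of_mem (by exact hxE),
        Real.one_rpow, mul_one]
    · rw [Set.indicator_of_notMem (by exact hxE), Set.indicator_of_notMem (by exact hxE),
        Real.zero_rpow (by linarith), mul_zero]
  have b1 := ae_re_apply_le_of_one_top hN.le hJ hBN hk₁ (by
    rw [lintegral_congr_ae (hk₁v.mono fun x hx => by rw [hx])]; exact hvJ)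
  have b2 := ae_re_apply_le_of_top_top hM.le one_pos hBM h2 (e2.mono fun x hx => by
    rw [hx, Complex.ofReal_re]
    exact Set.indicator_le_self' (fun _ _ => zero_le_one) x)
  have b4 := ae_re_apply_le_of_top_top hM.le hδ hBM h4 (h4'.mono fun _ hx => hx.2)
  have hsum : B v = B k₃ + B (v - k₃) := by rw [← map_add, add_sub_cancel]
  rw [hsum]
  filter_upwards [b1, b2, b4, hB.geoMeanLE hrp hrr h3 hk₁ h2 hgeo, Lp.coeFn_add (B k₃) (B (v - k₃)),
    lpTwo_nonneg_iff.1 (hB _ hk₁), lpTwo_nonneg_iff.1 (hB _ h2)] with x c1 c2 c4 cg c5 c6 c7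
  rw [c5, Pi.add_apply, Complex.add_re]
  refine add_le_add (cg.trans ?_) c4
  rw [mul_one] at c2
  exact mul_le_mul (Real.rpow_le_rpow c6.1 c1 hrp.le)
    (Real.rpow_le_rpow c7.1 c2 (by linarith)) (Real.rpow_nonneg c7.1 _) (by positivity)

end NormFromTo

/-! ### Self-improvement of the 1→∞ bound and its iteration -/

section Extrapolation

open scoped ComplexOrder

lemma extrapolation_constant {N M a p q : ℝ} (hN : 0 < N) (hM : 0 < M) (ha : 0 < a) (hp : 1 < p)
    (hq : q = 2 * p / (2 * p - 1)) :
    (N * ((a * (N ^ (q - 1) * M)) ^ (2 * p - 2) * (M ^ 2 * (N ^ (q - 1) * M)))) ^ (1 / (2 * p)) *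
      M ^ (1 - 1 / (2 * p)) = N ^ (1 / p) * M ^ 2 * a ^ (1 - 1 / p) := by
  obtain ⟨n, rfl⟩ : ∃ n, N = Real.exp n := ⟨_, (Real.exp_log hN).symm⟩
  obtain ⟨m, rfl⟩ : ∃ m, M = Real.exp m := ⟨_, (Real.exp_log hM).symm⟩
  obtain ⟨b, rfl⟩ : ∃ b, a = Real.exp b := ⟨_, (Real.exp_log ha).symm⟩
  simp only [← Real.exp_mul, ← Real.exp_add, ← Real.exp_nat_mul]
  congr 1
  have h1 : 2 * p - 1 ≠ 0 := by linarith
  have h2 : p ≠ 0 := by linarith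
  subst hq
  field_simp
  push_cast
  ring

variable {Ω : Type*} [MeasurableSpace Ω] {μ : Measure Ω}

/-- The three factors map L_1 to L_q, L_q to L_{2p} and L_{2p} to L_∞. Each outer one contributes
N^{1/(2p)}, in total N^{1/p} with exponent below 1; that is what makes the iteration contract. -/
lemma normFromTo_one_top_cube_le {S T U : Lp ℂ 2 μ →L[ℂ] Lp ℂ 2 μ} {p M N a : ℝ} (hp : 1 < p)
    (hM : 0 < M) (hN : 0 < N) (ha : 0 < a) (hS : IsPosOp S) (hT : IsPosOp T) (hU : IsPosOp U)
    (hlog : IsLogConvexTriple (1 - 1 / p) S T U) (hTa : normFromTo 1 ∞ T ≤ ENNReal.ofReal a)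
    (hUM : normFromTo 2 2 U ≤ ENNReal.ofReal M) (hS1 : normFromTo 1 1 S ≤ ENNReal.ofReal M)
    (hSM : normFromTo ∞ ∞ S ≤ ENNReal.ofReal M) (hSN : normFromTo 1 ∞ S ≤ ENNReal.ofReal N) :
    normFromTo 1 ∞ (S * S * S) ≤ ENNReal.ofReal (N ^ (1 / p) * M ^ 2 * a ^ (1 - 1 / p)) := by
  refine iSup₂_le fun f hf => ?_
  have hp0 : 0 < p := by linarith
  -- This q solves q(1 - 1/p) + (q/2)(1/p) = 1, so that u is the geometric mean of u^q, fed to T in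
  -- L_1, and u^{q/2}, fed to U in L_2; both are controlled by the same integral of u^q.
  set q := 2 * p / (2 * p - 1) with hq
  have hq1 : 1 ≤ q := by rw [hq, one_le_div (by linarith)]; linarith
  have hqp : q * (1 - 1 / p) + q / 2 * (1 / p) = 1 := by
    have : 2 * p - 1 ≠ 0 := by linarith
    rw [hq]; field_simp; ring
  have hp1 : 1 / p < 1 := (div_lt_one hp0).2 hp
  have hpp : 0 < 1 / p := by positivity
  set f₀ := lpTwoAbs f with hf₀
  have hf0 : 0 ≤ f₀ := lpTwoAbs_nonneg f
  have hf1 : ∫⁻ x, ENNReal.ofReal (f₀ x).re ∂μ ≤ ENNReal.ofReal 1 := by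
    rw [← eLpNorm_one_of_nonneg hf0, hf₀, eLpNorm_lpTwoAbs, ENNReal.ofReal_one]
    exact hf
  set u := S f₀ with hu
  have hu0 : 0 ≤ u := hS _ hf0
  have hu1 : ∫⁻ x, ENNReal.ofReal ((u x).re ^ (1 : ℝ)) ∂μ ≤ ENNReal.ofReal M := by
    simp only [Real.rpow_one]
    simpa using lintegral_apply_le_of_one_one one_pos hS hS1 hf0 hf1
  have huN : ∀ᵐ x ∂μ, (u x).re ≤ N := by
    simpa using ae_re_apply_le_of_one_top hN.le one_pos hSN hf0 hf1
  have huq := lintegral_rpow_le hu0 hN.le huN zero_le_one hq1 hu1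
  set J := N ^ (q - 1) * M with hJ
  have hJ0 : 0 < J := by positivity
  obtain ⟨f₁, hf₁, hf₁u⟩ := exists_lpTwo_rpow (s := q) hu0
    ((lintegral_rpow_le hu0 hN.le huN zero_le_one (by linarith : 1 ≤ 2 * q) hu1).trans_lt
      ENNReal.ofReal_lt_top)
  obtain ⟨g₁, hg₁, hg₁u⟩ := exists_lpTwo_rpow (s := q / 2) hu0 (by
    rw [mul_div_cancel₀ q two_ne_zero]
    exact huq.trans_lt ENNReal.ofReal_lt_top)
  have hu0' := lpTwo_nonneg_iff.1 hu0
  have hgeo : GeoMeanLE (1 - 1 / p) u f₁ g₁ := by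
    filter_upwards [hf₁u, hg₁u, hu0'] with x h1 h2 h3
    rw [h1, h2, ← Real.rpow_mul h3.1, ← Real.rpow_mul h3.1, sub_sub_cancel,
      ← Real.rpow_add_of_nonneg h3.1 (mul_nonneg (by linarith) (by linarith))
        (mul_nonneg (by linarith) hpp.le), hqp, Real.rpow_one]
  have hv := hlog _ _ _ hu0 hf₁ hg₁ hgeo
  have hTf := ae_re_apply_le_of_one_top ha.le hJ0 hTa hf₁ (by
    rw [lintegral_congr_ae (hf₁u.mono fun x hx => by rw [hx])]; exact huq)
  have hUg := lintegral_sq_apply_le_of_two_two hM.le hJ0 hU hUM hg₁ (by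
    rw [lintegral_congr_ae (g := fun x => ENNReal.ofReal ((u x).re ^ q)) ?_]
    · exact huq
    · filter_upwards [hg₁u, hu0'] with x h1 h2
      rw [h1, ← Real.rpow_natCast, ← Real.rpow_mul h2.1]
      norm_num)
  set v := S u with hvdef
  have hv0 : 0 ≤ v := hS _ hu0
  have hvK := ae_re_apply_le_of_top_top hM.le hN hSM hu0 huN
  have hvJ : ∫⁻ x, ENNReal.ofReal ((v x).re ^ (2 * p)) ∂μ ≤
      ENNReal.ofReal ((a * J) ^ (2 * p - 2) * (M ^ 2 * J)) := by
    calc _ ≤ ∫⁻ x, ENNReal.ofReal ((a * J) ^ (2 * p - 2)) *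
          ENNReal.ofReal ((U g₁ x).re ^ 2) ∂μ := by
          refine lintegral_mono_ae ?_
          filter_upwards [hv, hTf, lpTwo_nonneg_iff.1 (hT _ hf₁), lpTwo_nonneg_iff.1 (hU _ hg₁),
            lpTwo_nonneg_iff.1 hv0] with x h1 h2 h3 h4 h5
          rw [← ENNReal.ofReal_mul (by positivity)]
          refine ENNReal.ofReal_le_ofReal ?_
          rw [sub_sub_cancel] at h1
          calc (v x).re ^ (2 * p) ≤
                ((T f₁ x).re ^ (1 - 1 / p) * (U g₁ x).re ^ (1 / p)) ^ (2 * p) :=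
                Real.rpow_le_rpow h5.1 h1 (by linarith)
            _ = (T f₁ x).re ^ (2 * p - 2) * (U g₁ x).re ^ 2 := by
                rw [Real.mul_rpow (Real.rpow_nonneg h3.1 _) (Real.rpow_nonneg h4.1 _),
                  ← Real.rpow_mul h3.1, ← Real.rpow_mul h4.1, ← Real.rpow_natCast]
                congr 2
                · field_simp
                · push_cast; field_simp
            _ ≤ _ := mul_le_mul_of_nonneg_right (Real.rpow_le_rpow h3.1 h2 (by linarith))
                (sq_nonneg _)
      _ = ENNReal.ofReal ((a * J) ^ (2 * p - 2)) *
          ∫⁻ x, ENNReal.ofReal ((U g₁ x).re ^ 2) ∂μ :=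
          lintegral_const_mul' _ _ ENNReal.ofReal_ne_top
      _ ≤ ENNReal.ofReal ((a * J) ^ (2 * p - 2)) * ENNReal.ofReal (M ^ 2 * J) := by gcongr
      _ = _ := (ENNReal.ofReal_mul (by positivity)).symm
  have hδ : ∀ δ : ℝ, 0 < δ → eLpNorm ((S * S * S) f) ∞ μ ≤
      ENNReal.ofReal (N ^ (1 / p) * M ^ 2 * a ^ (1 - 1 / p) + M * δ) := by
    intro δ hδ
    have h1 := ae_re_apply_le_of_lintegral_rpow (r := 2 * p) (by linarith) hN hM (by positivity)
      (by positivity : 0 < M * N) hS hSN hSM hv0 hvK hvJ hδ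
    rw [hJ, extrapolation_constant hN hM ha hp hq] at h1
    rw [eLpNorm_exponent_top]
    refine eLpNormEssSup_le_of_ae_bound ?_
    filter_upwards [h1, ((hS.mul hS).mul hS).norm_apply_le_abs f] with x h2 h3
    exact h3.trans h2
  have hlim : Tendsto (fun δ : ℝ =>
      ENNReal.ofReal (N ^ (1 / p) * M ^ 2 * a ^ (1 - 1 / p) + M * δ)) (𝓝[>] 0)
      (𝓝 (ENNReal.ofReal (N ^ (1 / p) * M ^ 2 * a ^ (1 - 1 / p)))) := by
    have hc : Continuous fun δ : ℝ =>
        ENNReal.ofReal (N ^ (1 / p) * M ^ 2 * a ^ (1 - 1 / p) + M * δ) :=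
      ENNReal.continuous_ofReal.comp (by fun_prop)
    have := hc.tendsto 0
    rw [mul_zero, add_zero] at this
    exact this.mono_left nhdsWithin_le_nhds
  exact ge_of_tendsto hlim (by filter_upwards [self_mem_nhdsWithin] with δ h using hδ δ h)

/-- The theorem's constant D is the fixed point of the cube estimate at time s/3: D^{1-1/p} = 3^ν
c^{1-1/p} M^2. Hence only K changes. -/
lemma iteration_constant {p ν c M K s : ℝ} (hp : 1 < p) (hc : 0 < c) (hM : 0 < M) (hK : 0 < K)
    (hs : 0 < s) :
    (3 ^ (ν * p.conjExponent) * c * M ^ (2 * p.conjExponent) * K * (s / 3) ^ (-ν)) ^ (1 / p) *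
      M ^ 2 * (c * (s / 3) ^ (-ν)) ^ (1 - 1 / p) =
    3 ^ (ν * p.conjExponent) * c * M ^ (2 * p.conjExponent) * K ^ (1 / p) * s ^ (-ν) := by
  obtain ⟨c, rfl⟩ : ∃ n, c = Real.exp n := ⟨_, (Real.exp_log hc).symm⟩
  obtain ⟨m, rfl⟩ : ∃ m, M = Real.exp m := ⟨_, (Real.exp_log hM).symm⟩
  obtain ⟨k, rfl⟩ : ∃ k, K = Real.exp k := ⟨_, (Real.exp_log hK).symm⟩
  obtain ⟨s, rfl⟩ : ∃ b, s = Real.exp b := ⟨_, (Real.exp_log hs).symm⟩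
  obtain ⟨l, hl⟩ : ∃ l, (3 : ℝ) = Real.exp l := ⟨_, (Real.exp_log (by norm_num)).symm⟩
  rw [hl]
  simp only [← Real.exp_sub, ← Real.exp_mul, ← Real.exp_add, ← Real.exp_nat_mul]
  congr 1
  have h1 : p - 1 ≠ 0 := by linarith
  have h2 : p ≠ 0 := by linarith
  rw [Real.conjExponent]
  field_simp
  push_cast
  ring

lemma normFromTo_one_top_le_of_le_exp_smul {S T U : ℝ≥0 → Lp ℂ 2 μ →L[ℂ] Lp ℂ 2 μ}
    {p c ν M κ : ℝ} (hp : 1 < p) (hc : 0 < c) (hM : 0 < M) (hκ : 0 ≤ κ) (hS : IsC0Semigroup S)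
    (hSp : ∀ t, IsPosOp (S t)) (hTp : ∀ t, IsPosOp (T t)) (hUp : ∀ t, IsPosOp (U t))
    (hlog : ∀ t, IsLogConvexTriple (1 - 1 / p) (S t) (T t) (U t))
    (hT : ∀ t : ℝ≥0, 0 < t → normFromTo 1 ∞ (T t) ≤ ENNReal.ofReal (c * (t : ℝ) ^ (-ν)))
    (hU : ∀ t : ℝ≥0, 0 < t → normFromTo 2 2 (U t) ≤ ENNReal.ofReal M)
    (h11 : ∀ t : ℝ≥0, 0 < t → normFromTo 1 1 (S t) ≤ ENNReal.ofReal M)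
    (hinf : ∀ t : ℝ≥0, 0 < t → normFromTo ∞ ∞ (S t) ≤ ENNReal.ofReal M)
    (hST : ∀ t : ℝ≥0, PosOpLE (S t) (Real.exp (κ * t) • T t)) (t : ℝ≥0) (ht : 0 < t) :
    normFromTo 1 ∞ (S t) ≤ ENNReal.ofReal
      (3 ^ (ν * p.conjExponent) * c * M ^ (2 * p.conjExponent) * (t : ℝ) ^ (-ν)) := by
  set D : ℝ := 3 ^ (ν * p.conjExponent) * c * M ^ (2 * p.conjExponent) with hD
  have hD0 : 0 < D := by positivity
  have hp0 : 0 < p := by linarith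
  -- Chosen so that D x₀ s^{-ν} is the a priori bound for all s ≤ t obtained from domination by
  -- e^{κs} T(s).
  set x₀ : ℝ := Real.exp (κ * t) * c / D with hx₀
  have hx0 : 0 < x₀ := by positivity
  have key : ∀ n : ℕ, ∀ s : ℝ≥0, 0 < s → s ≤ t → normFromTo 1 ∞ (S s) ≤
      ENNReal.ofReal (D * x₀ ^ ((1 / p) ^ n) * (s : ℝ) ^ (-ν)) := by
    intro n
    induction n with
    | zero =>
      intro s hs hst
      have hDx : D * x₀ = Real.exp (κ * t) * c := by rw [hx₀]; field_simp
      rw [pow_zero, Real.rpow_one, hDx, mul_assoc, ENNReal.ofReal_mul (Real.exp_nonneg _)]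
      refine (normFromTo_mono (hSp s) (hST s) 1 ∞).trans ((normFromTo_smul_le _ _ _).trans ?_)
      rw [Real.enorm_eq_ofReal (Real.exp_nonneg _)]
      refine mul_le_mul' (ENNReal.ofReal_le_ofReal (Real.exp_le_exp.2 ?_)) (hT s hs)
      exact mul_le_mul_of_nonneg_left (by exact_mod_cast hst) hκ
    | succ n ih =>
      intro s hs hst
      have hs3 : 0 < s / 3 := by positivity
      have hsr : (0 : ℝ) < s := hs
      have hcoe : ((s / 3 : ℝ≥0) : ℝ) = (s : ℝ) / 3 := by push_cast; rfl
      have h1 := ih (s / 3) hs3 ((div_le_self zero_le (by norm_num)).trans hst)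
      have hTs := hT (s / 3) hs3
      rw [hcoe] at h1 hTs
      have h2 := normFromTo_one_top_cube_le hp hM (by positivity) (by positivity) (hSp (s / 3))
        (hTp (s / 3)) (hUp (s / 3)) (hlog (s / 3)) hTs (hU _ hs3) (h11 _ hs3) (hinf _ hs3) h1
      rw [hD, iteration_constant hp hc hM (Real.rpow_pos_of_pos hx0 _) hsr, ← hD,
        ← Real.rpow_mul hx0.le, ← pow_succ] at h2
      have h3 : S (s / 3) * S (s / 3) * S (s / 3) = S s := by
        rw [← hS.add, ← hS.add, add_thirds]
      rwa [h3] at h2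
  have hlim : Tendsto (fun n : ℕ => ENNReal.ofReal (D * x₀ ^ ((1 / p) ^ n) * (t : ℝ) ^ (-ν))) atTop
      (𝓝 (ENNReal.ofReal (D * (t : ℝ) ^ (-ν)))) := by
    have h1 : Tendsto (fun n : ℕ => (1 / p) ^ n) atTop (𝓝 0) :=
      tendsto_pow_atTop_nhds_zero_of_lt_one (by positivity) ((div_lt_one hp0).2 hp)
    have h2 : Tendsto (fun n : ℕ => x₀ ^ ((1 / p) ^ n)) atTop (𝓝 1) := by
      have := ((Real.continuous_const_rpow hx0.ne').tendsto 0).comp h1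
      rwa [Real.rpow_zero] at this
    have h3 := (h2.const_mul D).mul_const ((t : ℝ) ^ (-ν))
    rw [mul_one] at h3
    exact ENNReal.tendsto_ofReal h3
  exact ge_of_tendsto' hlim fun n => key n t ht le_rfl

/-- Norm convergence in L₂ gives almost everywhere convergence of a subsequence, which preserves a
common pointwise bound. -/
lemma normFromTo_top_le_of_tendsto {a : ℕ → Lp ℂ 2 μ →L[ℂ] Lp ℂ 2 μ}
    {A : Lp ℂ 2 μ →L[ℂ] Lp ℂ 2 μ} (h : ∀ f, Tendsto (fun n => a n f) atTop (𝓝 (A f)))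
    {q C : ℝ≥0∞} (ha : ∀ n, normFromTo q ∞ (a n) ≤ C) : normFromTo q ∞ A ≤ C := by
  refine iSup₂_le fun f hf => ?_
  rw [eLpNorm_exponent_top]
  refine eLpNormEssSup_le_of_ae_enorm_bound ?_
  obtain ⟨φ, -, hφ⟩ := (tendstoInMeasure_of_tendsto_Lp (h f)).exists_seq_tendsto_ae
  have h1 : ∀ᵐ x ∂μ, ∀ n, ‖a n f x‖ₑ ≤ C := ae_all_iff.2 fun n => by
    have h2 : eLpNorm (a n f) ∞ μ ≤ C :=
      (le_iSup₂_of_le (f := fun (f : Lp ℂ 2 μ) (_ : eLpNorm f q μ ≤ 1) => eLpNorm (a n f) ∞ μ)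
        f hf le_rfl).trans (ha n)
    rw [eLpNorm_exponent_top] at h2
    filter_upwards [ae_le_eLpNormEssSup (f := a n f) (μ := μ)] with x hx
    exact hx.trans h2
  filter_upwards [h1, hφ] with x hx hφx
  exact le_of_tendsto' hφx.enorm fun n => hx _

end Extrapolation

/-! ### The theorem, by truncating V from below -/

theorem mainTheorem7 {Ω : Type*} [MeasurableSpace Ω] (μ : Measure Ω)
    (T : ℝ≥0 → Lp ℂ 2 μ →L[ℂ] Lp ℂ 2 μ) (hT : IsC0Semigroup T) (hTpos : IsPositiveFamily T)
    (c ν : ℝ) (hc : 0 < c) (hν : 0 < ν)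
    (hultra : ∀ t : ℝ≥0, 0 < t → normFromTo 1 ∞ (T t) ≤ ENNReal.ofReal (c * (t : ℝ) ^ (-ν)))
    (V : Ω → ℝ) (hV : Measurable V) (p M : ℝ) (hp : 1 < p) (hM : 1 ≤ M)
    (hadm : IsAdmissible T fun x => p * V x)
    (h22 : ∀ t : ℝ≥0, 0 < t →
      normFromTo 2 2 (perturbedSemigroup T (fun x => p * V x) t) ≤ ENNReal.ofReal M)
    (h11 : ∀ t : ℝ≥0, 0 < t → normFromTo 1 1 (perturbedSemigroup T V t) ≤ ENNReal.ofReal M)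
    (hinf : ∀ t : ℝ≥0, 0 < t → normFromTo ∞ ∞ (perturbedSemigroup T V t) ≤ ENNReal.ofReal M) :
    IsAdmissible T V ∧ IsC0Semigroup (perturbedSemigroup T V) ∧
      ∀ t : ℝ≥0, 0 < t → normFromTo 1 ∞ (perturbedSemigroup T V t) ≤
        ENNReal.ofReal ((3 : ℝ) ^ (ν * p.conjExponent) * c * M ^ (2 * p.conjExponent)
          * (t : ℝ) ^ (-ν)) := by
  have hpos : ∀ t, IsPosOp (T t) := fun t f hf =>
    lpTwo_nonneg_iff.2 (hTpos t f (lpTwo_nonneg_iff.1 hf))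
  have hp0 : 0 < p := by linarith
  have hM0 : 0 < M := by linarith
  have hpp : 1 / p < 1 := (div_lt_one hp0).2 hp
  have hpp0 : 0 < 1 / p := by positivity
  obtain ⟨U, L, hpV⟩ := hadm.exists_isEnveloped hT hpos
  have hpVm : Measurable fun x => p * V x := hV.const_mul p
  -- Since p > 1, the positive and negative parts of V are at most those of pV, so the envelopes of
  -- pV serve V and all its truncations; this is why V is admissible.
  have hEV : IsEnveloped T V U L := hpV.mono fun x => by
    rcases le_total (V x) 0 with h | h
    · have h1 : p * V x ≤ V x := by nlinarith
      exact ⟨min_le_min h1 le_rfl, by rw [max_eq_right h]; exact le_max_right _ _⟩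
    · have h1 : V x ≤ p * V x := by nlinarith
      exact ⟨by rw [min_eq_right h]; exact min_le_right _ _, max_le_max h1 le_rfl⟩
  have hpVk : ∀ k : ℕ, IsEnveloped T (fun x => p * max (V x) (-(k : ℝ))) U L := fun k =>
    hpV.mono fun x => by
      have hk : (0 : ℝ) ≤ k := Nat.cast_nonneg k
      refine ⟨min_le_min (mul_le_mul_of_nonneg_left (le_max_left _ _) hp0.le) le_rfl,
        max_le ?_ (le_max_right _ _)⟩
      rw [mul_max_of_nonneg _ _ hp0.le]
      exact max_le_max le_rfl (by nlinarith)
  have hVk : ∀ k : ℕ, IsEnveloped T (fun x => max (V x) (-(k : ℝ))) U L := fun k =>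
    hEV.mono fun x => ⟨min_le_min (le_max_left _ _) le_rfl,
      max_le (max_le_max le_rfl (neg_nonpos.2 (Nat.cast_nonneg k))) (le_max_right _ _)⟩
  refine ⟨hEV.isAdmissible hT hpos hV, (hEV.perturbedSemigroup_spec hT hpos hV).1,
    fun t ht => ?_⟩
  -- Nothing yet makes the 1→∞ norm of T_V finite; for V ∨ (-k) it is, and the resulting bound is
  -- independent of k.
  refine normFromTo_top_le_of_tendsto (hEV.perturbedSemigroup_max_tendsto hT hpos hV hVk t)
    fun k => ?_
  have hVkm : Measurable fun x => max (V x) (-(k : ℝ)) := hV.max measurable_const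
  have hSk := (hVk k).perturbedSemigroup_isPosOp hT hpos hVkm
  have hle := hEV.perturbedSemigroup_anti hT hpos hV (hVk k) hVkm fun x => le_max_left _ _
  refine normFromTo_one_top_le_of_le_exp_smul (κ := k) hp hc hM0 (Nat.cast_nonneg k)
    ((hVk k).perturbedSemigroup_spec hT hpos hVkm).1 hSk hpos
    (hpV.perturbedSemigroup_isPosOp hT hpos hpVm) (fun s => ?_) hultra h22
    (fun s hs => (normFromTo_mono (hSk s) (hle s) 1 1).trans (h11 s hs))
    (fun s hs => (normFromTo_mono (hSk s) (hle s) ∞ ∞).trans (hinf s hs))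
    ((hVk k).perturbedSemigroup_le_exp_smul hT hpos hVkm (Nat.cast_nonneg k)
      fun x => le_max_right _ _) t ht
  -- The semigroup of p(V ∨ (-k)) is dominated by that of pV, which replaces it here so that the
  -- assumed 2→2 bound applies.
  exact ((hVk k).perturbedSemigroup_isLogConvexTriple hT hpos hVkm hp (hpVk k) s).mono
    (by linarith) (by linarith) (hpos s)
    ((hpVk k).perturbedSemigroup_isPosOp hT hpos (hVkm.const_mul p) s) (PosOpLE.refl _)
    (hpV.perturbedSemigroup_anti hT hpos hpVm (hpVk k) (hVkm.const_mul p)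
      (fun x => mul_le_mul_of_nonneg_left (le_max_left _ _) hp0.le) s)
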